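/- Let $G\subseteq GL(N+1,\mathbb{C})$ be a Zariski closed subgroup such that for some integer $k>0$ one has $\det(\sigma)^k=1$ for all $\sigma\in G$ (for example a closed reductive group such as $SL(N+1,\mathbb{C})$, $SO(N+1,\mathbb{C})$, $O(N+1,\mathbb{C})$, or $Sp(N+1,\mathbb{C})$ with $N+1$ even). Definitions. For a finite dimensional rational $G$-module $\mathbb{V}$, a maximal algebraic torus $T\le G$ with character lattice $M_{\mathbb{Z}}$, and $0\ne v\in\mathbb{V}$, let $\mathcal{N}(v)\subset M_{\mathbb{Z}}\otimes\mathbb{R}$ be the convex hull of the characters $\chi$ of $T$ for which the $\chi$-weight component of $v$ is nonzero. Let $I$ be the identity matrix in the $G$-module $\mathcal{GL}(N+1,\mathbb{C})$ of all square matrices of size $N+1$, on which $G$ acts by left multiplication. The degree $\deg(\mathbb{V})$ is the least integer $k>0$ such that $\mathcal{N}(v)\subseteq k\,\mathcal{N}(I)$ for all $0\neq v\in\mathbb{V}$ (and all $T$). For $v\in\mathbb{V}\setminus\{0\}$ and $w\in\mathbb{W}\setminus\{0\}$ in finite dimensional rational $G$-modules, the pair $(v,w)$ is semistable if the Zariski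 closures of the orbits $G\cdot[(v,w)]$ and $G\cdot[(v,0)]$ in $\mathbb{P}(\mathbb{V}\oplus\mathbb{W})$ are disjoint; it is stable if there is an integer $m>0$ such that the pair $(I^{\otimes q}\otimes v^{\otimes m},\,w^{\otimes(m+1)})$ is semistable, where $q=\deg(\mathbb{V})$. Let $G_{[v]}$ denote the stabilizer in $G$ of the line $\mathbb{C}v$. (1) If $(v,w)$ is a stable pair, then its automorphism group $G_{[v]}\cap G_{[w]}$ is finite. (2) Let $X\subset\mathbb{P}^N$ be a smooth irreducible closed subvariety of dimension $n$. For $l\in\{n-1,n\}$ let $Z_l(X)$ be the set of linear subspaces $E\subset\mathbb{P}^N$ of dimension $N-(l+1)$ for which there is a point $p\in X\cap E$ with $\dim(E\cap\mathbb{T}_p(X))\ge n-l$, where $\mathbb{T}_p(X)$ is the embedded tangent space. Suppose that $R_X$ (the resultant, $l=n$) and $\Delta_X$ (the hyperdiscriminant, $l=n-1$) are irreducible homogeneous polynomials in the entries of an $(l+1)\times(N+1)$ matrix $A$ whose zero sets are the Zariski closures of the sets of those $A$ of maximal rank with $\mathbb{P}(\ker A)\in Z_l(X)$. Let $G$ act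 on such polynomials by $(\sigma\cdot P)(A)=P(A\sigma)$. The variety $X$ is called stable (for the action of $G$) if such $R_X$ and $\Delta_X$ exist and $(R_X^{\deg\Delta_X},\Delta_X^{\deg R_X})$ is a stable pair, in the two $G$-modules of homogeneous polynomials of degree $\deg(R_X)\deg(\Delta_X)$ in the matrix entries. If $X$ is stable, then its automorphism group $\{\sigma\in G:\sigma X=X\}$ is finite. -/

import Mathlib

open scoped LinearAlgebra.Projectivization TensorProduct Pointwise

noncomputable section

namespace StablePair

/-! ### Zariski closures -/

/-- The set of nonzero vectors lying over a subset of a projective space. -/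
def affineCone {E : Type*} [AddCommGroup E] [Module ℂ E] (X : Set (ℙ ℂ E)) : Set E :=
  {x | ∃ h : x ≠ 0, Projectivization.mk ℂ x h ∈ X}

/-- The Zariski closure of a subset `S` of `ℙ(E)`: the common zeros of all homogeneous polynomial
functions on `E` that vanish on (the cone over) `S`. Polynomial functions on `E` are written
without coordinates, as polynomials in the linear functionals on `E`. -/
def projClosure {E : Type*} [AddCommGroup E] [Module ℂ E] (S : Set (ℙ ℂ E)) : Set (ℙ ℂ E) :=
  {p | ∀ (d : ℕ) (P : MvPolynomial (Module.Dual ℂ E) ℂ), P.IsHomogeneous d →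
    (∀ x ∈ affineCone S, MvPolynomial.eval (fun l => l x) P = 0) →
      MvPolynomial.eval (fun l => l p.rep) P = 0}

/-! ### Linear algebraic groups, tori and characters -/

variable {N : ℕ}

/-- The matrix entries of `g` and of `g⁻¹`; polynomials in these are the regular functions
on `GL(N+1, ℂ)`. -/
def groupCoord (g : GL (Fin (N + 1)) ℂ) :
    (Fin (N + 1) × Fin (N + 1)) ⊕ (Fin (N + 1) × Fin (N + 1)) → ℂ :=
  Sum.elim (fun p => (g : Matrix (Fin (N + 1)) (Fin (N + 1)) ℂ) p.1 p.2)
    (fun p => ((g⁻¹ : GL (Fin (N + 1)) ℂ) : Matrix (Fin (N + 1)) (Fin (N + 1)) ℂ) p.1 p.2)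

/-- `G` is Zariski closed in `GL(N+1, ℂ)`, i.e. it is a linear algebraic group. -/
def IsZariskiClosed (G : Subgroup (GL (Fin (N + 1)) ℂ)) : Prop :=
  ∃ S : Set (MvPolynomial (Fin (N + 1) × Fin (N + 1)) ℂ), ∀ g : GL (Fin (N + 1)) ℂ,
    g ∈ G ↔ ∀ P ∈ S, MvPolynomial.eval
      (fun p => (g : Matrix (Fin (N + 1)) (Fin (N + 1)) ℂ) p.1 p.2) P = 0

variable {G : Subgroup (GL (Fin (N + 1)) ℂ)}

/-- A regular (polynomial in the entries of `t` and `t⁻¹`) function on a subgroup `T` of `G`. -/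
def IsRegularFun (T : Subgroup G) (f : T → ℂ) : Prop :=
  ∃ P : MvPolynomial ((Fin (N + 1) × Fin (N + 1)) ⊕ (Fin (N + 1) × Fin (N + 1))) ℂ,
    ∀ t : T, f t = MvPolynomial.eval (groupCoord ((t : G) : GL (Fin (N + 1)) ℂ)) P

/-- `T` is an algebraic torus: isomorphic, as an algebraic group, to some `(ℂˣ)ʳ`. -/
def IsTorus (T : Subgroup G) : Prop :=
  ∃ (r : ℕ) (φ : (Fin r → ℂˣ) ≃* T),
    (∀ c, ∃ P : MvPolynomial (Fin r ⊕ Fin r) ℂ, ∀ z : Fin r → ℂˣ,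
      groupCoord ((φ z : G) : GL (Fin (N + 1)) ℂ) c =
        MvPolynomial.eval (Sum.elim (fun k => (z k : ℂ)) (fun k => ((z k)⁻¹ : ℂ))) P) ∧
    (∀ k, IsRegularFun T (fun t => (φ.symm t k : ℂ)))

/-- `T` is a maximal algebraic torus of `G`. -/
def IsMaximalTorus (T : Subgroup G) : Prop :=
  Maximal IsTorus T

/-- The character lattice `M_ℤ` of `T`, written multiplicatively: the homomorphisms `T → ℂˣ`
that are regular. -/
def charGroup (T : Subgroup G) : Subgroup (T →* ℂˣ) where
  carrier := {χ | IsRegularFun T (fun t => (χ t : ℂ))}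
  one_mem' := ⟨1, fun t => by simp⟩
  mul_mem' := by
    rintro χ ψ ⟨P, hP⟩ ⟨Q, hQ⟩
    exact ⟨P * Q, fun t => by
      have h1 := hP t
      have h2 := hQ t
      simp only at h1 h2
      simp [h1, h2]⟩
  inv_mem' := by
    rintro χ ⟨P, hP⟩
    refine ⟨MvPolynomial.rename Sum.swap P, fun t => ?_⟩
    have h := hP t⁻¹
    simp only [map_inv] at h
    rw [MvPolynomial.eval_rename]
    simp only [MonoidHom.inv_apply]
    rw [h]
    congr 1
    congr 1
    funext c
    rcases c with c | c <;> simp [groupCoord]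

/-- `M_ℝ = M_ℤ ⊗ ℝ`. -/
abbrev CharSpace (T : Subgroup G) : Type :=
  ℝ ⊗[ℤ] Additive (charGroup T)

/-- The image of a character in `M_ℝ`. -/
def charVec (T : Subgroup G) (χ : charGroup T) : CharSpace T :=
  (1 : ℝ) ⊗ₜ[ℤ] Additive.ofMul χ

/-! ### Representations, weights, degree -/

section Rep

variable {V : Type*} [AddCommGroup V] [Module ℂ V]
variable {W : Type*} [AddCommGroup W] [Module ℂ W]

/-- `ρ` is a rational representation: its matrix coefficients are regular functions on `G`. -/
def IsRational (ρ : Representation ℂ G V) : Prop :=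
  ∀ (l : Module.Dual ℂ V) (v : V),
    ∃ P : MvPolynomial ((Fin (N + 1) × Fin (N + 1)) ⊕ (Fin (N + 1) × Fin (N + 1))) ℂ,
      ∀ g : G, l (ρ g v) = MvPolynomial.eval (groupCoord (g : GL (Fin (N + 1)) ℂ)) P

/-- The `T`-support `𝒜(v)`: the characters `χ` for which the component `v_χ` of `v` in the weight
space of `χ` is nonzero. Here `f` is the decomposition of `v` into weight vectors. -/
def weightSupport (ρ : Representation ℂ G V) (T : Subgroup G) (v : V) : Set (charGroup T) :=
  {χ | ∃ f : charGroup T →₀ V,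
    (∀ (ψ : charGroup T) (t : T), ρ (t : G) (f ψ) = ((ψ : T →* ℂˣ) t : ℂ) • f ψ) ∧
    (f.sum fun _ x => x) = v ∧ f χ ≠ 0}

/-- The weight polytope `𝒩(v) = conv 𝒜(v) ⊆ M_ℝ`. -/
def weightPolytope (ρ : Representation ℂ G V) (T : Subgroup G) (v : V) : Set (CharSpace T) :=
  convexHull ℝ (charVec T '' weightSupport ρ T v)

/-- The action of `G` on square matrices of size `N+1` by left multiplication. -/
def leftRegular (G : Subgroup (GL (Fin (N + 1)) ℂ)) :
    Representation ℂ G (Matrix (Fin (N + 1)) (Fin (N + 1)) ℂ) where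
  toFun g := LinearMap.mulLeft ℂ ((g : GL (Fin (N + 1)) ℂ) : Matrix (Fin (N + 1)) (Fin (N + 1)) ℂ)
  map_one' := by ext; simp
  map_mul' g h := by
    apply LinearMap.ext
    intro A
    simp

/-- The degree of a `G`-module: the least positive integer `k` such that `𝒩(v) ⊆ k 𝒩(I)` for all
`v ≠ 0` (and for every maximal torus). -/
def repDegree (ρ : Representation ℂ G V) : ℕ :=
  sInf {k | 0 < k ∧ ∀ T : Subgroup G, IsMaximalTorus T → ∀ v : V, v ≠ 0 →
    weightPolytope ρ T v ⊆ (k : ℝ) • weightPolytope (leftRegular G) T 1}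

/-- The action of `G` on `V^{⊗ m}`. -/
def tensorPowRep (ρ : Representation ℂ G V) (m : ℕ) :
    Representation ℂ G (PiTensorProduct ℂ (fun _ : Fin m => V)) where
  toFun g := PiTensorProduct.map (fun _ => ρ g)
  map_one' := by
    simp only [map_one]
    exact PiTensorProduct.map_one
  map_mul' g h := by
    simp only [map_mul]
    exact PiTensorProduct.map_mul _ _

/-- `v^{⊗ m}`. -/
def tensorPow (v : V) (m : ℕ) : PiTensorProduct ℂ (fun _ : Fin m => V) :=
  PiTensorProduct.tprod ℂ (fun _ => v)

/-! ### Semistable and stable pairs -/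

/-- The projective orbit `G · [x] ⊆ ℙ(V)` of a nonzero vector `x`. -/
def projOrbit (ρ : Representation ℂ G V) (x : V) : Set (ℙ ℂ V) :=
  {p | ∃ (g : G) (h : ρ g x ≠ 0), p = Projectivization.mk ℂ (ρ g x) h}

/-- The pair `(v, w)` is semistable: the Zariski closures of `G · [(v, w)]` and `G · [(v, 0)]`
in `ℙ(V ⊕ W)` are disjoint. -/
def IsSemistablePair (ρ : Representation ℂ G V) (τ : Representation ℂ G W) (v : V) (w : W) :
    Prop :=
  Disjoint (projClosure (projOrbit (ρ.prod τ) (v, w)))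
    (projClosure (projOrbit (ρ.prod τ) (v, 0)))

/-- The pair `(v, w)` is stable: for some `m > 0` the pair `(I^{⊗ q} ⊗ v^{⊗ m}, w^{⊗ (m+1)})` is
semistable, where `q` is the degree of `V`. -/
def IsStablePair (ρ : Representation ℂ G V) (τ : Representation ℂ G W) (v : V) (w : W) : Prop :=
  ∃ m : ℕ, 0 < m ∧
    IsSemistablePair
      ((tensorPowRep (leftRegular G) (repDegree ρ)).tprod (tensorPowRep ρ m))
      (tensorPowRep τ (m + 1))
      (tensorPow (1 : Matrix (Fin (N + 1)) (Fin (N + 1)) ℂ) (repDegree ρ) ⊗ₜ[ℂ] tensorPow v m)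
      (tensorPow w (m + 1))

/-- The stabilizer `G_[v]` of the line through `v`. -/
def lineStabilizer (ρ : Representation ℂ G V) (v : V) : Subgroup G where
  carrier := {g | ∃ c : ℂˣ, ρ g v = (c : ℂ) • v}
  one_mem' := ⟨1, by simp⟩
  mul_mem' := by
    rintro g h ⟨c, hc⟩ ⟨d, hd⟩
    exact ⟨d * c, by simp [hc, hd, smul_smul]⟩
  inv_mem' := by
    rintro g ⟨c, hc⟩
    refine ⟨c⁻¹, ?_⟩
    have h : ρ g⁻¹ (ρ g v) = v := by simp
    rw [hc, map_smul] at h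
    calc ρ g⁻¹ v = ((c⁻¹ : ℂˣ) : ℂ) • ((c : ℂ) • ρ g⁻¹ v) := by simp [smul_smul]
      _ = _ := by rw [h]

/-- The automorphism group `G_[v] ∩ G_[w]` of the pair `(v, w)`. -/
def pairAut (ρ : Representation ℂ G V) (τ : Representation ℂ G W) (v : V) (w : W) : Subgroup G :=
  lineStabilizer ρ v ⊓ lineStabilizer τ w

end Rep

/-! ### Projective varieties, resultants and hyperdiscriminants -/

/-- The homogeneous ideal of `X ⊆ ℙ^N`. -/
def homogIdeal (X : Set (ℙ ℂ (Fin (N + 1) → ℂ))) : Ideal (MvPolynomial (Fin (N + 1)) ℂ) :=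
  MvPolynomial.vanishingIdeal ℂ (affineCone X)

/-- The `(n+1)`-dimensional linear subspace of `ℂ^{N+1}` whose projectivization is the embedded
tangent space to `X` at `[x]`. -/
def embTangent (X : Set (ℙ ℂ (Fin (N + 1) → ℂ))) (x : Fin (N + 1) → ℂ) :
    Submodule ℂ (Fin (N + 1) → ℂ) :=
  ⨅ F ∈ homogIdeal X, LinearMap.ker
    (∑ i, (MvPolynomial.eval x (MvPolynomial.pderiv i F)) •
      (LinearMap.proj i : (Fin (N + 1) → ℂ) →ₗ[ℂ] ℂ))

/-- `X ⊆ ℙ^N` is a smooth irreducible closed subvariety of dimension `n`. -/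
structure IsSmoothVariety (n : ℕ) (X : Set (ℙ ℂ (Fin (N + 1) → ℂ))) : Prop where
  closed : projClosure X = X
  irreducible : (homogIdeal X).IsPrime
  dim : ringKrullDim (MvPolynomial (Fin (N + 1)) ℂ ⧸ homogIdeal X) = ((n + 1 : ℕ) : WithBot ℕ∞)
  smooth : ∀ x ∈ affineCone X, Module.finrank ℂ (embTangent X x) = n + 1

/-- The matrix with given entries. -/
def toMat {k : ℕ} (a : Fin k × Fin (N + 1) → ℂ) : Matrix (Fin k) (Fin (N + 1)) ℂ :=
  Matrix.of fun i j => a (i, j)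

/-- For `k = l + 1`, the preimage of `Z_l(X)` in the `k × (N+1)` matrices of maximal rank: those
`A` for which there is a point `[x]` of `X` in the projectivization `E` of `ker A` with
`dim (E ∩ 𝕋_[x] X) ≥ n - l` (as projective subspaces). -/
def coisotropicSet (n k : ℕ) (X : Set (ℙ ℂ (Fin (N + 1) → ℂ))) :
    Set (Fin k × Fin (N + 1) → ℂ) :=
  {a | (toMat a).rank = k ∧ ∃ x ∈ affineCone X, (toMat a).mulVec x = 0 ∧
    n + 2 ≤ k + Module.finrank ℂ
      (LinearMap.ker (toMat a).mulVecLin ⊓ embTangent X x : Submodule ℂ (Fin (N + 1) → ℂ))}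

/-- `P` is an irreducible polynomial whose zero set is the Zariski closure of the preimage of
`Z_{k-1}(X)` in the space of `k × (N+1)` matrices. For `k = n + 1` this means that `P` is the
`X`-resultant (Cayley-Chow form), for `k = n` that it is the `X`-hyperdiscriminant. -/
def IsDefiningPoly (n k : ℕ) (X : Set (ℙ ℂ (Fin (N + 1) → ℂ)))
    (P : MvPolynomial (Fin k × Fin (N + 1)) ℂ) : Prop :=
  Irreducible P ∧ {a | MvPolynomial.eval a P = 0} =
    MvPolynomial.zeroLocus ℂ (MvPolynomial.vanishingIdeal ℂ (coisotropicSet n k X))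

/-- The substitution `A ↦ A σ` on polynomials in the entries of a `k × (N+1)` matrix `A`. -/
def polySubst (k : ℕ) (s : Matrix (Fin (N + 1)) (Fin (N + 1)) ℂ) :
    MvPolynomial (Fin k × Fin (N + 1)) ℂ →ₐ[ℂ] MvPolynomial (Fin k × Fin (N + 1)) ℂ :=
  MvPolynomial.aeval fun p => ∑ l, MvPolynomial.C (s l p.2) * MvPolynomial.X (p.1, l)

theorem polySubst_isHomogeneous (k r : ℕ) (s : Matrix (Fin (N + 1)) (Fin (N + 1)) ℂ)
    {P : MvPolynomial (Fin k × Fin (N + 1)) ℂ} (hP : P.IsHomogeneous r) :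
    (polySubst k s P).IsHomogeneous r := by
  have h := hP.aeval (fun p : Fin k × Fin (N + 1) =>
    ∑ l, MvPolynomial.C (s l p.2) * MvPolynomial.X (p.1, l)) (n := 1)
    (fun p => MvPolynomial.IsHomogeneous.sum _ _ _ fun l _ =>
      MvPolynomial.isHomogeneous_C_mul_X _ _)
  simpa [polySubst] using h

theorem polySubst_one (k : ℕ) :
    polySubst k (1 : Matrix (Fin (N + 1)) (Fin (N + 1)) ℂ) = AlgHom.id ℂ _ := by
  apply MvPolynomial.algHom_ext
  rintro ⟨i, j⟩
  simp [polySubst, Matrix.one_apply]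

theorem polySubst_mul (k : ℕ) (s t : Matrix (Fin (N + 1)) (Fin (N + 1)) ℂ) :
    polySubst k (s * t) = (polySubst k s).comp (polySubst k t) := by
  apply MvPolynomial.algHom_ext
  rintro ⟨i, j⟩
  simp only [polySubst, AlgHom.comp_apply, MvPolynomial.aeval_X, map_sum, map_mul,
    MvPolynomial.algHom_C, MvPolynomial.algebraMap_eq, Matrix.mul_apply, Finset.sum_mul,
    Finset.mul_sum]
  rw [Finset.sum_comm]
  refine Finset.sum_congr rfl fun a _ => Finset.sum_congr rfl fun b _ => ?_
  ring

/-- The action `(σ · P)(A) = P(A σ)` of `G` on the homogeneous polynomials of degree `r` in the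
entries of a `k × (N+1)` matrix `A`. -/
def polyRep (G : Subgroup (GL (Fin (N + 1)) ℂ)) (k r : ℕ) :
    Representation ℂ G (MvPolynomial.homogeneousSubmodule (Fin k × Fin (N + 1)) ℂ r) where
  toFun g := (polySubst k ((g : GL (Fin (N + 1)) ℂ) :
    Matrix (Fin (N + 1)) (Fin (N + 1)) ℂ)).toLinearMap.restrict
      (fun _ hP => polySubst_isHomogeneous k r _ hP)
  map_one' := by
    apply LinearMap.ext
    intro P
    apply Subtype.ext
    simp [LinearMap.restrict_apply, polySubst_one]
  map_mul' g h := by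
    apply LinearMap.ext
    intro P
    apply Subtype.ext
    change polySubst k (((g * h : G) : GL (Fin (N + 1)) ℂ) :
      Matrix (Fin (N + 1)) (Fin (N + 1)) ℂ) P = _
    rw [Subgroup.coe_mul, Units.val_mul, polySubst_mul]
    rfl

/-- The `n`-dimensional variety `X ⊆ ℙ^N`, with resultant `R` of degree `a` and hyperdiscriminant
`D` of degree `b`, is stable for the action of `G`: the pair `(R ^ b, D ^ a)` is stable. -/
def IsStableVariety (G : Subgroup (GL (Fin (N + 1)) ℂ)) (n : ℕ)
    (X : Set (ℙ ℂ (Fin (N + 1) → ℂ))) : Prop :=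
  ∃ (R : MvPolynomial (Fin (n + 1) × Fin (N + 1)) ℂ) (D : MvPolynomial (Fin n × Fin (N + 1)) ℂ)
    (a b : ℕ) (hR : R.IsHomogeneous a) (hD : D.IsHomogeneous b),
    IsDefiningPoly n (n + 1) X R ∧ IsDefiningPoly n n X D ∧
    IsStablePair (polyRep G (n + 1) (a * b)) (polyRep G n (a * b))
      ⟨R ^ b, hR.pow b⟩ ⟨D ^ a, mul_comm b a ▸ hD.pow a⟩

/-- The group of all `σ ∈ G` with `σ X = X`. -/
def varietyAut (G : Subgroup (GL (Fin (N + 1)) ℂ)) (X : Set (ℙ ℂ (Fin (N + 1) → ℂ))) :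
    Subgroup G where
  carrier := {g | ∀ x : Fin (N + 1) → ℂ,
    ((g : GL (Fin (N + 1)) ℂ) : Matrix (Fin (N + 1)) (Fin (N + 1)) ℂ).mulVec x ∈ affineCone X ↔
      x ∈ affineCone X}
  one_mem' := fun x => by simp
  mul_mem' := by
    intro g h hg hh x
    have := hg (((h : GL (Fin (N + 1)) ℂ) : Matrix (Fin (N + 1)) (Fin (N + 1)) ℂ).mulVec x)
    rw [hh x, Matrix.mulVec_mulVec] at this
    simpa using this
  inv_mem' := by
    intro g hg x
    have := hg ((((g : GL (Fin (N + 1)) ℂ)⁻¹ : GL (Fin (N + 1)) ℂ) :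
      Matrix (Fin (N + 1)) (Fin (N + 1)) ℂ).mulVec x)
    rw [Matrix.mulVec_mulVec, ← Units.val_mul, mul_inv_cancel, Units.val_one,
      Matrix.one_mulVec] at this
    exact this.symm

end StablePair

end

/-! A bounded affine variety is finite, so it suffices to show that H = G_[v] ∩ G_[w] is Zariski
closed and bounded. For g in H with gv = cv and gw = dw, semistability of (I^q ⊗ v^m, w^(m+1)) gives
|c|^m ‖g‖^q ≤ C |d|^(m+1) with C independent of g (`IsSemistablePair.exists_bound`); otherwise
suitably scaled points of the orbit would converge to a point (y^q ⊗ v^m, 0), with y ≠ 0, lying in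
both closures. Since |det g| = 1, norms on G are bounded below, so the estimate for all powers of g
yields |c|^m ≤ |d|^(m+1), and the one for g⁻¹ yields equality. What remains is ‖g‖^q ≤ C.

This needs q > 0 (`IsRational.repDegree_pos`), that is, some multiple of 𝒩(I) must contain every
weight polytope of V. Weights of V are products of boundedly many characters χ_i of the standard
representation and their inverses. As det^k = 1, the χ_i sum to zero in M_ℝ, so 0 lies in 𝒩(I) and
each -χ_i lies in (N+1) 𝒩(I).

For a variety, σX = X implies that σ preserves the zero sets of R_X and Δ_X, hence by the
Nullstellensatz fixes both irreducible polynomials up to scalars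
(`IsDefiningPoly.exists_polySubst_eq`). Thus the automorphism group of X embeds in that of the pair.
-/

namespace StablePair

/-! ### Finiteness of bounded affine varieties -/

/-- A polynomial that is not a unit modulo `I` vanishes at some point of the zero locus of `I`. -/
theorem exists_mem_zeroLocus_of_not_isUnit {σ : Type*} [Finite σ]
    (I : Ideal (MvPolynomial σ ℂ)) (Q : MvPolynomial σ ℂ)
    (hQ : ¬ IsUnit (Ideal.Quotient.mk I Q)) :
    ∃ x ∈ MvPolynomial.zeroLocus ℂ I, MvPolynomial.eval x Q = 0 := by
  obtain ⟨m, hm, hQm⟩ := exists_max_ideal_of_mem_nonunits hQ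
  have hm' : (m.comap (Ideal.Quotient.mk I)).IsMaximal :=
    Ideal.comap_isMaximal_of_surjective _ Ideal.Quotient.mk_surjective
  obtain ⟨x, hx⟩ := MvPolynomial.isMaximal_iff_eq_vanishingIdeal_singleton.1 hm'
  refine ⟨x, fun p hp => ?_, ?_⟩
  · have : p ∈ m.comap (Ideal.Quotient.mk I) := by
      rw [Ideal.mem_comap, Ideal.Quotient.eq_zero_iff_mem.2 hp]
      exact m.zero_mem
    rw [hx] at this
    simpa using (MvPolynomial.mem_vanishingIdeal_singleton_iff x p).1 this
  · have : Q ∈ m.comap (Ideal.Quotient.mk I) := hQm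
    rw [hx] at this
    simpa using (MvPolynomial.mem_vanishingIdeal_singleton_iff x Q).1 this

/-- A bounded affine variety over `ℂ` is finite. -/
theorem finite_zeroLocus_of_bounded {σ : Type*} [Fintype σ]
    (I : Ideal (MvPolynomial σ ℂ)) (C : ℝ)
    (hC : ∀ x ∈ MvPolynomial.zeroLocus ℂ I, ∀ i, ‖x i‖ ≤ C) :
    (MvPolynomial.zeroLocus ℂ I).Finite := by
  by_cases hI : I = ⊤
  · subst hI
    rw [MvPolynomial.zeroLocus_top]
    exact Set.finite_empty
  have : Nontrivial (MvPolynomial σ ℂ ⧸ I) := Ideal.Quotient.nontrivial_iff.2 hI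
  obtain ⟨s, g, hg, hint⟩ := exists_integral_inj_algHom_of_fg ℂ (MvPolynomial σ ℂ ⧸ I)
  -- A Noether variable would take every complex value on the zero locus: `X i - z` is never a unit,
  -- and an injective integral extension reflects units. The value |M| + 1 exceeds the bound on a
  -- ball containing the locus.
  have hs : IsEmpty (Fin s) := by
    refine ⟨fun i => ?_⟩
    obtain ⟨Q, hQ⟩ := Ideal.Quotient.mk_surjective (g (MvPolynomial.X i))
    obtain ⟨M, hM⟩ := (isCompact_closedBall (0 : σ → ℂ) (max C 0)).exists_bound_of_continuousOn
      (MvPolynomial.continuous_eval Q).continuousOn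
    set z : ℂ := ((|M| + 1 : ℝ) : ℂ) with hz
    have hnu : ¬ IsUnit (Ideal.Quotient.mk I (Q - MvPolynomial.C z)) := by
      intro hu
      have he : Ideal.Quotient.mk I (Q - MvPolynomial.C z)
          = g (MvPolynomial.X i - MvPolynomial.C z) := by
        rw [map_sub, hQ, map_sub]
        congr 1
        exact (g.commutes z).symm
      rw [he] at hu
      have hloc : IsLocalHom g.toRingHom := RingHom.IsIntegral.isLocalHom hint hg
      have h1 : IsUnit (MvPolynomial.X i - MvPolynomial.C z : MvPolynomial (Fin s) ℂ) :=
        hloc.map_nonunit _ hu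
      have h2 := h1.map (MvPolynomial.eval fun _ => z)
      simp at h2
    obtain ⟨x, hx, hx0⟩ := exists_mem_zeroLocus_of_not_isUnit I _ hnu
    have hxb : x ∈ Metric.closedBall (0 : σ → ℂ) (max C 0) := by
      rw [mem_closedBall_zero_iff, pi_norm_le_iff_of_nonneg (le_max_right _ _)]
      exact fun j => (hC x hx j).trans (le_max_left _ _)
    have h3 := hM x hxb
    rw [map_sub, MvPolynomial.eval_C, sub_eq_zero] at hx0
    rw [hx0, hz, Complex.norm_real, Real.norm_eq_abs, abs_of_pos (by positivity)] at h3
    linarith [le_abs_self M]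
  -- Without Noether variables the coordinate ring is integral over ℂ, so each coordinate takes
  -- values among the roots of one monic polynomial.
  have key : ∀ i : σ, ∃ p : Polynomial ℂ, p.Monic ∧
      Polynomial.aeval (Ideal.Quotient.mk I (MvPolynomial.X i)) p = 0 := by
    intro i
    obtain ⟨p, hp, hp0⟩ := hint (Ideal.Quotient.mk I (MvPolynomial.X i))
    refine ⟨p.map (MvPolynomial.isEmptyAlgEquiv ℂ (Fin s)).toAlgHom.toRingHom, hp.map _, ?_⟩
    have hcomp : (algebraMap ℂ (MvPolynomial σ ℂ ⧸ I)).comp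
        (MvPolynomial.isEmptyAlgEquiv ℂ (Fin s)).toAlgHom.toRingHom = g.toRingHom := by
      refine RingHom.ext fun q => ?_
      rw [MvPolynomial.eq_C_of_isEmpty q]
      have h1 : (MvPolynomial.isEmptyAlgEquiv ℂ (Fin s))
          (MvPolynomial.C (MvPolynomial.coeff 0 q)) = MvPolynomial.coeff 0 q :=
        (MvPolynomial.isEmptyAlgEquiv ℂ (Fin s)).commutes _
      refine (congrArg (algebraMap ℂ (MvPolynomial σ ℂ ⧸ I)) h1).trans ?_
      exact (g.commutes _).symm
    rw [Polynomial.aeval_def, Polynomial.eval₂_map, hcomp]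
    exact hp0
  choose p hp hp0 using key
  refine (Set.Finite.pi' fun i => (p i).rootSet_finite ℂ).subset fun x hx i => ?_
  rw [Polynomial.mem_rootSet_of_ne (hp i).ne_zero]
  let e : MvPolynomial σ ℂ ⧸ I →ₐ[ℂ] ℂ := Ideal.Quotient.liftₐ I (MvPolynomial.aeval x) hx
  have h4 : e (Ideal.Quotient.mk I (MvPolynomial.X i)) = x i := by
    change MvPolynomial.aeval x (MvPolynomial.X i) = x i
    simp
  have := congrArg e (hp0 i)
  rwa [← Polynomial.aeval_algHom_apply, h4, map_zero] at this

end StablePair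

/-! ### Semistability as a norm bound -/

namespace StablePair

theorem eval_mul_of_isHomogeneous {σ : Type*} {P : MvPolynomial σ ℂ} {d : ℕ}
    (hP : P.IsHomogeneous d) (c : ℂ) (x : σ → ℂ) :
    MvPolynomial.eval (fun i => c * x i) P = c ^ d * MvPolynomial.eval x P := by
  rw [MvPolynomial.eval_eq, MvPolynomial.eval_eq, Finset.mul_sum]
  refine Finset.sum_congr rfl fun m hm => ?_
  have h := hP (MvPolynomial.mem_support_iff.1 hm)
  have h1 : ∑ i ∈ m.support, m i = d := by
    rw [← h, Finsupp.weight_apply, Finsupp.sum]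
    simp
  simp only [mul_pow, Finset.prod_mul_distrib, Finset.prod_pow_eq_pow_sum, h1]
  ring

/-- Limits, tested on linear functionals, of points over `S` lie in the closure of `S`. -/
theorem mk_mem_projClosure_of_tendsto {E : Type*} [AddCommGroup E] [Module ℂ E]
    {S : Set (ℙ ℂ E)} {x : ℕ → E} {y : E} (hx : ∀ n, x n ∈ affineCone S) (hy : y ≠ 0)
    (h : ∀ l : Module.Dual ℂ E, Filter.Tendsto (fun n => l (x n)) Filter.atTop (nhds (l y))) :
    Projectivization.mk ℂ y hy ∈ projClosure S := by
  intro d P hP hPS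
  have h0 : MvPolynomial.eval (fun l : Module.Dual ℂ E => l y) P = 0 := by
    have ht : Filter.Tendsto (fun n => MvPolynomial.eval (fun l : Module.Dual ℂ E => l (x n)) P)
        Filter.atTop (nhds (MvPolynomial.eval (fun l : Module.Dual ℂ E => l y) P)) :=
      ((MvPolynomial.continuous_eval P).tendsto _).comp (tendsto_pi_nhds.2 h)
    refine tendsto_nhds_unique ht ?_
    simp only [hPS _ (hx _), tendsto_const_nhds]
  -- `projClosure` evaluates at a chosen representative, a multiple of `y`; homogeneity transfers
  -- the vanishing.
  obtain ⟨a, ha⟩ := Projectivization.exists_smul_eq_mk_rep ℂ y hy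
  rw [← ha]
  have := eval_mul_of_isHomogeneous hP (a : ℂ) (fun l : Module.Dual ℂ E => l y)
  rw [h0, mul_zero] at this
  rw [← this]
  congr 2
  funext l
  simp [Units.smul_def]

theorem smul_mem_affineCone_projOrbit {N : ℕ} {G : Subgroup (GL (Fin (N + 1)) ℂ)} {V : Type*}
    [AddCommGroup V] [Module ℂ V] (ρ : Representation ℂ G V) (x : V) (g : G) {a : ℂ}
    (ha : a ≠ 0) (hx : ρ g x ≠ 0) : a • ρ g x ∈ affineCone (projOrbit ρ x) := by
  refine ⟨smul_ne_zero ha hx, g, hx, ?_⟩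
  rw [Projectivization.mk_eq_mk_iff']
  exact ⟨a, rfl⟩

/-- The point [(u, 0)] lies in both orbit closures: replacing `w` by 0 does not change the limit.
Testing convergence on functionals avoids topologies on `V` and `W`. -/
theorem IsSemistablePair.false_of_tendsto {N : ℕ} {G : Subgroup (GL (Fin (N + 1)) ℂ)}
    {V W : Type*} [AddCommGroup V] [Module ℂ V] [AddCommGroup W] [Module ℂ W]
    {ρ : Representation ℂ G V} {τ : Representation ℂ G W} {v : V} {w : W}
    (h : IsSemistablePair ρ τ v w) (hv : v ≠ 0) (g : ℕ → G) (a : ℕ → ℂ) (ha : ∀ n, a n ≠ 0)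
    {u : V} (hu : u ≠ 0)
    (hρ : ∀ l : Module.Dual ℂ V,
      Filter.Tendsto (fun n => l (a n • ρ (g n) v)) Filter.atTop (nhds (l u)))
    (hτ : ∀ l : Module.Dual ℂ W,
      Filter.Tendsto (fun n => l (a n • τ (g n) w)) Filter.atTop (nhds 0)) : False := by
  have hu' : ((u, 0) : V × W) ≠ 0 := by simpa using hu
  have hinj : ∀ n, ρ (g n) v ≠ 0 := fun n h0 => hv (by
    have := congrArg (ρ (g n)⁻¹) h0
    simpa using this)
  have key : ∀ w' : W, (∀ l : Module.Dual ℂ W,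
      Filter.Tendsto (fun n => l (a n • τ (g n) w')) Filter.atTop (nhds 0)) →
      Projectivization.mk ℂ ((u, 0) : V × W) hu' ∈ projClosure (projOrbit (ρ.prod τ) (v, w')) := by
    intro w' hw'
    refine mk_mem_projClosure_of_tendsto (x := fun n => a n • (ρ.prod τ) (g n) (v, w'))
      (fun n => smul_mem_affineCone_projOrbit _ _ _ (ha n) ?_) hu' fun l => ?_
    · intro h0
      exact hinj n (congrArg Prod.fst h0)
    · have h1 := hρ (l ∘ₗ LinearMap.inl ℂ V W)
      have h2 := hw' (l ∘ₗ LinearMap.inr ℂ V W)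
      have h3 := h1.add h2
      rw [add_zero] at h3
      refine h3.congr fun n => ?_
      rw [LinearMap.comp_apply, LinearMap.comp_apply, ← map_add]
      congr 1
      ext <;> simp [Representation.prod]
  exact Set.disjoint_left.1 h (key w hτ) (key 0 (by simp))

theorem tensorPow_smul {V : Type*} [AddCommGroup V] [Module ℂ V] (c : ℂ) (v : V) (m : ℕ) :
    tensorPow (c • v) m = c ^ m • tensorPow v m := by
  have := (PiTensorProduct.tprod ℂ (s := fun _ : Fin m => V)).map_smul_univ
    (fun _ => c) (fun _ => v)
  simpa [tensorPow] using this

theorem tmul_ne_zero {V W : Type*} [AddCommGroup V] [Module ℂ V] [AddCommGroup W] [Module ℂ W]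
    {v : V} {w : W} (hv : v ≠ 0) (hw : w ≠ 0) : v ⊗ₜ[ℂ] w ≠ 0 := by
  obtain ⟨f, hf⟩ := Module.Projective.exists_dual_ne_zero ℂ hv
  obtain ⟨g, hg⟩ := Module.Projective.exists_dual_ne_zero ℂ hw
  intro h
  have := congrArg (LinearMap.mul' ℂ ℂ ∘ₗ TensorProduct.map f g) h
  simp [hf, hg] at this

theorem tensorPow_ne_zero {V : Type*} [AddCommGroup V] [Module ℂ V] {v : V} (hv : v ≠ 0)
    (m : ℕ) : tensorPow v m ≠ 0 := by
  obtain ⟨f, hf⟩ := Module.Projective.exists_dual_ne_zero ℂ hv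
  intro h
  have := congrArg (PiTensorProduct.lift
    ((MultilinearMap.mkPiAlgebra ℂ (Fin m) ℂ).compLinearMap fun _ => f)) h
  simp [tensorPow, hf] at this

/-- In a basis the diagonal is a polynomial in the coordinates. This passes limits through y ↦
y^{⊗q} without a topology on the tensor power. -/
theorem continuous_multilinear_diag {M : Type*} [NormedAddCommGroup M] [NormedSpace ℂ M]
    [FiniteDimensional ℂ M] {q : ℕ} (f : MultilinearMap ℂ (fun _ : Fin q => M) ℂ) :
    Continuous fun y => f fun _ => y := by
  let b := Module.finBasis ℂ M
  have h : (fun y => f fun _ => y) = fun y =>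
      ∑ r : Fin q → Fin (Module.finrank ℂ M), (∏ i, b.coord (r i) y) • f fun i => b (r i) := by
    funext y
    conv_lhs => rw [← b.sum_repr y]
    rw [MultilinearMap.map_sum]
    exact Finset.sum_congr rfl fun r _ => f.map_smul_univ _ _
  rw [h]
  have hc (i) : Continuous (b.coord i) := LinearMap.continuous_of_finiteDimensional _
  fun_prop

open scoped Matrix.Norms.Elementwise in
/-- Along elements stabilizing the lines of a stable pair, semistability becomes a norm bound. -/
theorem IsSemistablePair.exists_bound {N : ℕ} {G : Subgroup (GL (Fin (N + 1)) ℂ)}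
    {V W : Type*} [AddCommGroup V] [Module ℂ V] [AddCommGroup W] [Module ℂ W]
    {ρ : Representation ℂ G V} {τ : Representation ℂ G W} {v : V} {w : W} {q m k : ℕ}
    (h : IsSemistablePair ((tensorPowRep (leftRegular G) q).tprod (tensorPowRep ρ m))
      (tensorPowRep τ k)
      (tensorPow (1 : Matrix (Fin (N + 1)) (Fin (N + 1)) ℂ) q ⊗ₜ[ℂ] tensorPow v m)
      (tensorPow w k)) (hv : v ≠ 0) :
    ∃ C : ℝ, ∀ (g : G) (c d : ℂ), ρ g v = c • v → τ g w = d • w →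
      ‖c‖ ^ m * ‖((g : GL (Fin (N + 1)) ℂ) : Matrix (Fin (N + 1)) (Fin (N + 1)) ℂ)‖ ^ q
        ≤ C * ‖d‖ ^ k := by
  by_contra! hcon
  choose g c d hc hd hlt using fun n : ℕ => hcon n
  set M : ℕ → Matrix (Fin (N + 1)) (Fin (N + 1)) ℂ :=
    fun n => ((g n : GL (Fin (N + 1)) ℂ) : Matrix (Fin (N + 1)) (Fin (N + 1)) ℂ) with hM
  have hM0 : ∀ n, M n ≠ 0 := fun n => (g n : GL (Fin (N + 1)) ℂ).ne_zero
  have hpos : ∀ n, 0 < ‖c n‖ ^ m * ‖M n‖ ^ q := fun n =>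
    lt_of_le_of_lt (by positivity) (hlt n)
  -- Failure of the bound already forces the scalars to be nonzero.
  have hcm : ∀ n, c n ^ m ≠ 0 := fun n h0 => by
    have := hpos n
    rw [← norm_pow, h0] at this
    simp at this
  have : ProperSpace (Matrix (Fin (N + 1)) (Fin (N + 1)) ℂ) := FiniteDimensional.proper ℂ _
  obtain ⟨y, hy, φ, hφ, hlim⟩ := (isCompact_sphere
    (0 : Matrix (Fin (N + 1)) (Fin (N + 1)) ℂ) 1).tendsto_subseq
    (x := fun n => ((‖M n‖⁻¹ : ℝ) : ℂ) • M n) (fun n => by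
      rw [mem_sphere_zero_iff_norm, norm_smul, Complex.norm_real, norm_inv, norm_norm,
        inv_mul_cancel₀ (norm_ne_zero_iff.2 (hM0 n))])
  have hy0 : y ≠ 0 := by
    rintro rfl
    simp at hy
  have hvm : tensorPow v m ≠ 0 := tensorPow_ne_zero hv m
  -- Dividing by c^m ‖M‖^q turns the first component into (M/‖M‖)^{⊗q} ⊗ v^{⊗m}, which converges
  -- along the subsequence, and scales w^{⊗k} by a factor of modulus at most 1/n.
  refine h.false_of_tendsto (tmul_ne_zero (tensorPow_ne_zero one_ne_zero q) hvm)
    (fun n => g (φ n)) (fun n => (c (φ n) ^ m * (‖M (φ n)‖ : ℂ) ^ q)⁻¹) (fun n => ?_)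
    (tmul_ne_zero (tensorPow_ne_zero hy0 q) hvm) (fun l => ?_) (fun l => ?_)
  · exact inv_ne_zero (mul_ne_zero (hcm _) (pow_ne_zero _
      (Complex.ofReal_ne_zero.2 (norm_ne_zero_iff.2 (hM0 _)))))
  · let f : MultilinearMap ℂ (fun _ : Fin q => Matrix (Fin (N + 1)) (Fin (N + 1)) ℂ) ℂ :=
      (l ∘ₗ (TensorProduct.mk ℂ _ _).flip (tensorPow v m)).compMultilinearMap
        (PiTensorProduct.tprod ℂ)
    refine (((continuous_multilinear_diag f).tendsto y).comp hlim).congr fun n => ?_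
    change l (tensorPow (((‖M (φ n)‖⁻¹ : ℝ) : ℂ) • M (φ n)) q ⊗ₜ[ℂ] tensorPow v m) = _
    congr 1
    have h1 : tensorPowRep (leftRegular G) q (g (φ n)) (tensorPow 1 q) = tensorPow (M (φ n)) q := by
      simp [tensorPowRep, tensorPow, leftRegular, hM]
    have h2 : tensorPowRep ρ m (g (φ n)) (tensorPow v m) = c (φ n) ^ m • tensorPow v m := by
      rw [← tensorPow_smul, ← hc]
      simp [tensorPowRep, tensorPow]
    rw [Representation.tprod_apply, TensorProduct.map_tmul, h1, h2, tensorPow_smul,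
      TensorProduct.tmul_smul, smul_smul, TensorProduct.smul_tmul']
    congr 1
    rw [mul_inv, mul_right_comm, inv_mul_cancel₀ (hcm _)]
    simp
  · have h2 : ∀ n, tensorPowRep τ k (g n) (tensorPow w k) = d n ^ k • tensorPow w k := by
      intro n
      rw [← tensorPow_smul, ← hd]
      simp [tensorPowRep, tensorPow]
    have h3 : Filter.Tendsto (fun n => ((c n ^ m * (‖M n‖ : ℂ) ^ q)⁻¹ * d n ^ k))
        Filter.atTop (nhds 0) := by
      rw [tendsto_zero_iff_norm_tendsto_zero]
      refine squeeze_zero' (Filter.Eventually.of_forall fun n => norm_nonneg _)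
        ?_ tendsto_inv_atTop_nhds_zero_nat
      filter_upwards [Filter.eventually_gt_atTop 0] with n hn
      have hn' : (0 : ℝ) < n := Nat.cast_pos.2 hn
      simp only [norm_mul, norm_inv, norm_pow, Complex.norm_real, norm_norm]
      rw [inv_mul_le_iff₀ (hpos n), ← div_eq_mul_inv, le_div_iff₀ hn', mul_comm]
      exact (hlt n).le
    have h4 := ((h3.comp hφ.tendsto_atTop).mul_const (l (tensorPow w k)))
    rw [zero_mul] at h4
    refine h4.congr fun n => ?_
    simp only [h2, map_smul, smul_eq_mul, Function.comp_apply]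
    ring

end StablePair

/-! ### Boundedness and closedness of the automorphism group of a pair -/

namespace StablePair

open scoped Matrix.Norms.Elementwise in
-- The determinant is continuous and vanishes at 0.
theorem exists_le_norm_of_norm_det_eq_one (N : ℕ) :
    ∃ δ : ℝ, 0 < δ ∧ ∀ A : Matrix (Fin (N + 1)) (Fin (N + 1)) ℂ, ‖A.det‖ = 1 → δ ≤ ‖A‖ := by
  have hc : Continuous fun A : Matrix (Fin (N + 1)) (Fin (N + 1)) ℂ => A.det :=
    Continuous.matrix_det continuous_id
  obtain ⟨δ, hδ, h⟩ := Metric.continuousAt_iff.1 (hc.continuousAt (x := 0)) 1 one_pos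
  refine ⟨δ, hδ, fun A hA => not_lt.1 fun hlt => ?_⟩
  have := h (x := A) (by simpa using hlt)
  rw [Matrix.det_zero, dist_zero_right] at this
  linarith

theorem pow_apply_of_apply_eq_smul {H V : Type*} [Monoid H] [AddCommGroup V] [Module ℂ V]
    (ρ : Representation ℂ H V) {g : H} {v : V} {c : ℂ} (h : ρ g v = c • v) (k : ℕ) :
    ρ (g ^ k) v = c ^ k • v := by
  induction k with
  | zero => simp
  | succ k ih => rw [pow_succ, map_mul, Module.End.mul_apply, h, map_smul, ih, smul_smul, pow_succ']

theorem inv_apply_of_apply_eq_smul {H V : Type*} [Group H] [AddCommGroup V] [Module ℂ V]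
    (ρ : Representation ℂ H V) {g : H} {v : V} {c : ℂ} (hc : c ≠ 0) (h : ρ g v = c • v) :
    ρ g⁻¹ v = c⁻¹ • v := by
  have h1 : ρ g⁻¹ (ρ g v) = v := by simp
  rw [h, map_smul] at h1
  rw [← h1, smul_smul, inv_mul_cancel₀ hc, one_smul, h1]

variable {N : ℕ} {G : Subgroup (GL (Fin (N + 1)) ℂ)}
  {V W : Type*} [AddCommGroup V] [Module ℂ V] [AddCommGroup W] [Module ℂ W]
  {ρ : Representation ℂ G V} {τ : Representation ℂ G W} {v : V} {w : W}

open scoped Matrix.Norms.Elementwise in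
-- Applied to g^j, the bound gives (|c|^m / |d|^k)^j ≤ C / δ^q for every j, so the ratio is at most
-- 1; g⁻¹ gives the reverse inequality. The scalars then cancel from the bound for g.
theorem exists_norm_le_of_mem_pairAut {q m k : ℕ} (hq : 0 < q)
    (hdet : ∀ g ∈ G, ‖(g : Matrix (Fin (N + 1)) (Fin (N + 1)) ℂ).det‖ = 1)
    (h : IsSemistablePair ((tensorPowRep (leftRegular G) q).tprod (tensorPowRep ρ m))
      (tensorPowRep τ k)
      (tensorPow (1 : Matrix (Fin (N + 1)) (Fin (N + 1)) ℂ) q ⊗ₜ[ℂ] tensorPow v m)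
      (tensorPow w k)) (hv : v ≠ 0) :
    ∃ C : ℝ, ∀ g ∈ pairAut ρ τ v w,
      ‖((g : GL (Fin (N + 1)) ℂ) : Matrix (Fin (N + 1)) (Fin (N + 1)) ℂ)‖ ≤ C := by
  obtain ⟨C, hC⟩ := h.exists_bound hv
  obtain ⟨δ, hδ, hδ'⟩ := exists_le_norm_of_norm_det_eq_one N
  have key : ∀ (g : G) (c d : ℂ), d ≠ 0 → ρ g v = c • v → τ g w = d • w →
      ‖c‖ ^ m ≤ ‖d‖ ^ k := by
    intro g c d hd0 hc hd
    by_contra! hlt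
    have hdk : 0 < ‖d‖ ^ k := by positivity
    have hr : 1 < ‖c‖ ^ m / ‖d‖ ^ k := (one_lt_div hdk).2 hlt
    obtain ⟨j, hj⟩ := pow_unbounded_of_one_lt (C / δ ^ q) hr
    have h1 := hC (g ^ j) (c ^ j) (d ^ j) (pow_apply_of_apply_eq_smul ρ hc j)
      (pow_apply_of_apply_eq_smul τ hd j)
    have h2 := pow_le_pow_left₀ hδ.le (hδ' _ (hdet _ (g ^ j).2)) q
    have h3 : ‖c ^ j‖ ^ m * δ ^ q ≤ C * ‖d ^ j‖ ^ k :=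
      (mul_le_mul_of_nonneg_left h2 (by positivity)).trans h1
    rw [div_pow, div_lt_div_iff₀ (by positivity) (by positivity)] at hj
    rw [norm_pow, norm_pow, ← pow_mul, ← pow_mul, mul_comm j m, mul_comm j k, pow_mul, pow_mul]
      at h3
    linarith
  -- Either ‖g‖ ≤ 1, or ‖g‖ ≤ ‖g‖^q ≤ C because q > 0.
  refine ⟨max 1 C, ?_⟩
  rintro g ⟨⟨c, hc⟩, ⟨d, hd⟩⟩
  have h1 := key g⁻¹ _ _ (inv_ne_zero d.ne_zero) (inv_apply_of_apply_eq_smul ρ c.ne_zero hc)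
    (inv_apply_of_apply_eq_smul τ d.ne_zero hd)
  have hc0 : 0 < ‖(c : ℂ)‖ ^ m := pow_pos (norm_pos_iff.2 c.ne_zero) _
  have hd0 : 0 < ‖(d : ℂ)‖ ^ k := pow_pos (norm_pos_iff.2 d.ne_zero) _
  rw [norm_inv, norm_inv, inv_pow, inv_pow, inv_le_inv₀ hc0 hd0] at h1
  have h2 := hC g c d hc hd
  rw [le_max_iff, or_iff_not_imp_left, not_le]
  intro hg
  have h3 : ‖((g : GL (Fin (N + 1)) ℂ) : Matrix (Fin (N + 1)) (Fin (N + 1)) ℂ)‖ ≤ _ :=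
    le_self_pow₀ hg.le hq.ne'
  refine h3.trans ?_
  have h4 := (mul_le_mul_of_nonneg_right h1 (pow_nonneg (norm_nonneg
    ((g : GL (Fin (N + 1)) ℂ) : Matrix (Fin (N + 1)) (Fin (N + 1)) ℂ)) q)).trans h2
  rw [mul_comm] at h4
  exact le_of_mul_le_mul_right h4 hd0

theorem groupCoord_injective : Function.Injective (groupCoord (N := N)) := by
  intro g h hgh
  apply Units.ext
  ext i j
  exact congrFun hgh (Sum.inl (i, j))

/-- This expresses the stabilizer of a line by vanishing of matrix coefficients, which are regular
functions for a rational representation. -/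
theorem mem_lineStabilizer_of_dual (hv : v ≠ 0) {g : G}
    (h : ∀ l : Module.Dual ℂ V, l v = 0 → l (ρ g v) = 0) : g ∈ lineStabilizer ρ v := by
  have h1 : ρ g v ∈ Submodule.span ℂ {v} := by
    by_contra hn
    obtain ⟨l, hl, hl'⟩ := Submodule.exists_dual_map_eq_bot_of_notMem hn inferInstance
    refine hl (h l ?_)
    have : l v ∈ (Submodule.span ℂ {v}).map l :=
      Submodule.mem_map_of_mem (Submodule.mem_span_singleton_self v)
    rwa [hl', Submodule.mem_bot] at this
  obtain ⟨c, hc⟩ := Submodule.mem_span_singleton.1 h1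
  have hc0 : c ≠ 0 := by
    rintro rfl
    rw [zero_smul] at hc
    have := congrArg (ρ g⁻¹) hc
    simp [eq_comm, hv] at this
  exact ⟨Units.mk0 c hc0, hc.symm⟩

/-- The automorphism group of a pair is Zariski closed in the affine variety `GL(N+1, ℂ)`. -/
theorem exists_eq_groupCoord_of_mem_zeroLocus (hG : IsZariskiClosed G) (hρ : IsRational ρ)
    (hτ : IsRational τ) (hv : v ≠ 0) (hw : w ≠ 0)
    {x : (Fin (N + 1) × Fin (N + 1)) ⊕ (Fin (N + 1) × Fin (N + 1)) → ℂ}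
    (hx : x ∈ MvPolynomial.zeroLocus ℂ (MvPolynomial.vanishingIdeal ℂ
      ((fun g : G => groupCoord (g : GL (Fin (N + 1)) ℂ)) '' pairAut ρ τ v w))) :
    ∃ g ∈ pairAut ρ τ v w, groupCoord (g : GL (Fin (N + 1)) ℂ) = x := by
  have hx' : ∀ P : MvPolynomial ((Fin (N + 1) × Fin (N + 1)) ⊕ (Fin (N + 1) × Fin (N + 1))) ℂ,
      (∀ g ∈ pairAut ρ τ v w, MvPolynomial.eval (groupCoord (g : GL (Fin (N + 1)) ℂ)) P = 0) →
      MvPolynomial.eval x P = 0 := by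
    intro P hP
    have := hx P (MvPolynomial.mem_vanishingIdeal_iff.2 (by
      rintro _ ⟨g, hg, rfl⟩
      simpa using hP g hg))
    simpa using this
  let A : Matrix (Fin (N + 1)) (Fin (N + 1)) ℂ := Matrix.of fun i j => x (Sum.inl (i, j))
  let B : Matrix (Fin (N + 1)) (Fin (N + 1)) ℂ := Matrix.of fun i j => x (Sum.inr (i, j))
  -- The relation g g⁻¹ = 1 is polynomial in the coordinates, so it persists on the closure and
  -- makes the limit point invertible.
  have hAB : A * B = 1 := by
    ext i j
    have := hx' (∑ k, MvPolynomial.X (Sum.inl (i, k)) * MvPolynomial.X (Sum.inr (k, j))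
      - MvPolynomial.C ((1 : Matrix (Fin (N + 1)) (Fin (N + 1)) ℂ) i j)) (by
        intro g _
        have h1 : ((g : GL (Fin (N + 1)) ℂ) : Matrix (Fin (N + 1)) (Fin (N + 1)) ℂ) *
          ((g : GL (Fin (N + 1)) ℂ)⁻¹ : GL (Fin (N + 1)) ℂ) = 1 := Units.mul_inv _
        have h2 := congrFun (congrFun h1 i) j
        rw [Matrix.mul_apply] at h2
        simp only [map_sub, map_sum, map_mul, MvPolynomial.eval_X, MvPolynomial.eval_C, groupCoord,
          Sum.elim_inl, Sum.elim_inr]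
        rw [sub_eq_zero]
        exact h2)
    simp only [map_sub, map_sum, map_mul, MvPolynomial.eval_X, MvPolynomial.eval_C,
      sub_eq_zero] at this
    exact this
  let γ : GL (Fin (N + 1)) ℂ := ⟨A, B, hAB, mul_eq_one_comm.1 hAB⟩
  have hγx : groupCoord γ = x := by
    funext c
    rcases c with c | c <;> rfl
  obtain ⟨S, hS⟩ := hG
  have hγ : γ ∈ G := by
    refine (hS γ).2 fun P hP => ?_
    have := hx' (MvPolynomial.rename Sum.inl P) (by
      intro g _
      rw [MvPolynomial.eval_rename]
      exact (hS g).1 g.2 P hP)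
    rw [MvPolynomial.eval_rename] at this
    exact this
  refine ⟨⟨γ, hγ⟩, ⟨mem_lineStabilizer_of_dual hv fun l hl => ?_,
    mem_lineStabilizer_of_dual hw fun l hl => ?_⟩, hγx⟩
  · obtain ⟨P, hP⟩ := hρ l v
    rw [hP ⟨γ, hγ⟩, hγx]
    refine hx' P fun g hg => ?_
    obtain ⟨c, hc⟩ := hg.1
    rw [← hP, hc, map_smul, hl, smul_zero]
  · obtain ⟨P, hP⟩ := hτ l w
    rw [hP ⟨γ, hγ⟩, hγx]
    refine hx' P fun g hg => ?_
    obtain ⟨c, hc⟩ := hg.2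
    rw [← hP, hc, map_smul, hl, smul_zero]

open scoped Matrix.Norms.Elementwise in
-- Entries of g⁻¹ obey the same bound, since the group contains inverses; so its closed image under
-- `groupCoord` is bounded.
theorem finite_pairAut_of_bounded (hG : IsZariskiClosed G) (hρ : IsRational ρ)
    (hτ : IsRational τ) (hv : v ≠ 0) (hw : w ≠ 0) {C : ℝ}
    (hC : ∀ g ∈ pairAut ρ τ v w,
      ‖((g : GL (Fin (N + 1)) ℂ) : Matrix (Fin (N + 1)) (Fin (N + 1)) ℂ)‖ ≤ C) :
    Finite (pairAut ρ τ v w) := by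
  have h := finite_zeroLocus_of_bounded (MvPolynomial.vanishingIdeal ℂ
      ((fun g : G => groupCoord (g : GL (Fin (N + 1)) ℂ)) '' pairAut ρ τ v w)) C (by
    intro x hx i
    obtain ⟨g, hg, rfl⟩ := exists_eq_groupCoord_of_mem_zeroLocus hG hρ hτ hv hw hx
    rcases i with ⟨i, j⟩ | ⟨i, j⟩
    · exact (Matrix.norm_entry_le_entrywise_sup_norm
        ((g : GL (Fin (N + 1)) ℂ) : Matrix (Fin (N + 1)) (Fin (N + 1)) ℂ)).trans (hC g hg)
    · exact (Matrix.norm_entry_le_entrywise_sup_norm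
        (((g⁻¹ : G) : GL (Fin (N + 1)) ℂ) : Matrix (Fin (N + 1)) (Fin (N + 1)) ℂ)).trans (hC g⁻¹ (inv_mem hg)))
  have h1 := h.subset (MvPolynomial.zeroLocus_vanishingIdeal_le _)
  exact (h1.of_finite_image
    ((groupCoord_injective.comp Subtype.val_injective).injOn)).to_subtype

end StablePair

/-! ### Diagonalization of tori -/

namespace StablePair

theorem eval_mem_subalgebra {T σ : Type*} (A : Subalgebra ℂ (T → ℂ)) (f : T → σ → ℂ)
    (hf : ∀ c, (fun t => f t c) ∈ A) (P : MvPolynomial σ ℂ) :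
    (fun t => MvPolynomial.eval (f t) P) ∈ A := by
  induction P using MvPolynomial.induction_on with
  | C a =>
    simp only [MvPolynomial.eval_C]
    exact A.algebraMap_mem a
  | add p q hp hq =>
    simp only [map_add]
    exact A.add_mem hp hq
  | mul_X p c hp =>
    simp only [map_mul, MvPolynomial.eval_X]
    exact A.mul_mem hp (hf c)

/-- Since `1 ≤ M`, the powers of `M` increase, and monomials of all degrees up to `D` fit into `M ^
D`. This keeps track of how many characters get multiplied. -/
theorem eval_mem_pow {T σ : Type*} {M : Submodule ℂ (T → ℂ)} (hM : 1 ≤ M) (f : T → σ → ℂ)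
    (hf : ∀ c, (fun t => f t c) ∈ M) (P : MvPolynomial σ ℂ) {D : ℕ} (hD : P.totalDegree ≤ D) :
    (fun t => MvPolynomial.eval (f t) P) ∈ M ^ D := by
  have h : (fun t => MvPolynomial.eval (f t) P) =
      ∑ m ∈ P.support, P.coeff m • ∏ i ∈ m.support, (fun t => f t i) ^ m i := by
    funext t
    rw [MvPolynomial.eval_eq]
    simp
  rw [h]
  refine Submodule.sum_mem _ fun m hm => Submodule.smul_mem _ _ ?_
  refine pow_le_pow_right₀ hM ((MvPolynomial.le_totalDegree hm).trans hD) ?_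
  rw [Finsupp.sum]
  induction m.support using Finset.cons_induction with
  | empty => exact ⟨1, by simp⟩
  | cons a s ha ih =>
    rw [Finset.prod_cons, Finset.sum_cons, pow_add]
    exact Submodule.mul_mem_mul (Submodule.pow_mem_pow _ (hf a) _) ih

/-- The span of the characters of a monoid, as an algebra of functions. -/
def characterAlgebra (T : Type*) [Monoid T] : Subalgebra ℂ (T → ℂ) :=
  Algebra.adjoin ℂ (Set.range fun χ : T →* ℂ => (χ : T → ℂ))

/-- Characters are closed under multiplication. -/
theorem mem_span_of_mem_characterAlgebra {T : Type*} [Monoid T] {f : T → ℂ}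
    (hf : f ∈ characterAlgebra T) :
    f ∈ Submodule.span ℂ (Set.range fun χ : T →* ℂ => (χ : T → ℂ)) := by
  have h : f ∈ Subalgebra.toSubmodule (characterAlgebra T) := hf
  rw [characterAlgebra, Algebra.adjoin_eq_span] at h
  refine Submodule.span_mono ?_ h
  intro g hg
  induction hg using Submonoid.closure_induction with
  | mem x hx => exact hx
  | one => exact ⟨1, rfl⟩
  | mul x y _ _ hx hy =>
    obtain ⟨χ, rfl⟩ := hx
    obtain ⟨ψ, rfl⟩ := hy
    exact ⟨χ * ψ, rfl⟩

/-- A matrix representation whose entries are combinations of characters is diagonalizable. -/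
theorem exists_eigenbasis_of_entries_mem {T : Type*} [Monoid T] {n : ℕ}
    (π : T →* Matrix (Fin n) (Fin n) ℂ) (h : ∀ i j, (fun t => π t i j) ∈ characterAlgebra T) :
    ∃ (b : Module.Basis (Fin n) ℂ (Fin n → ℂ)) (χ : Fin n → T →* ℂ),
      ∀ t i, (π t).mulVec (b i) = χ i t • b i := by
  have hspan : ⊤ ≤ Submodule.span ℂ
      {v : Fin n → ℂ | ∃ χ : T →* ℂ, ∀ t, (π t).mulVec v = χ t • v} := by
    intro v _
    have hv : ∀ i, ∃ a : (T →* ℂ) →₀ ℂ, ∀ t, (π t).mulVec v i = a.sum fun χ x => x * χ t := by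
      intro i
      have h1 : (fun t => (π t).mulVec v i) ∈ characterAlgebra T := by
        have : (fun t => (π t).mulVec v i) = ∑ j, v j • fun t => π t i j := by
          funext t
          simp [Matrix.mulVec, dotProduct, mul_comm]
        rw [this]
        exact sum_mem fun j _ => Subalgebra.smul_mem _ (h i j) _
      obtain ⟨a, ha⟩ := Finsupp.mem_span_range_iff_exists_finsupp.1
        (mem_span_of_mem_characterAlgebra h1)
      refine ⟨a, fun t => ?_⟩
      have := congrFun ha t
      rw [← this, Finsupp.sum, Finsupp.sum, Finset.sum_apply]
      simp
    choose a ha using hv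
    classical
    let s : Finset (T →* ℂ) := Finset.univ.biUnion fun i => (a i).support
    let u : (T →* ℂ) → Fin n → ℂ := fun χ i => a i χ
    have hu : ∀ t, (π t).mulVec v = ∑ χ ∈ s, χ t • u χ := by
      intro t
      funext i
      rw [ha, Finsupp.sum_of_support_subset _
        (Finset.subset_biUnion_of_mem (fun i => (a i).support) (Finset.mem_univ i)) _ (by simp)]
      simp [u, s, mul_comm]
    -- Expand π(tr)v = π(t)π(r)v as a function of r in two ways and compare coefficients, using
    -- independence of characters.
    have heig : ∀ χ ∈ s, ∀ t, (π t).mulVec (u χ) = χ t • u χ := by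
      intro χ hχ t
      funext i
      have h1 : ∑ ψ ∈ s, ((π t).mulVec (u ψ) i - ψ t * u ψ i) • (ψ : T → ℂ) = 0 := by
        funext r
        have h2 : (π (t * r)).mulVec v = (π t).mulVec ((π r).mulVec v) := by
          rw [map_mul, Matrix.mulVec_mulVec]
        rw [hu, hu, Matrix.mulVec_sum] at h2
        have h3 := congrFun h2 i
        simp only [Finset.sum_apply, Matrix.mulVec_smul, Pi.smul_apply, smul_eq_mul,
          map_mul] at h3
        simp only [Finset.sum_apply, Pi.smul_apply, smul_eq_mul, sub_mul, Finset.sum_sub_distrib,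
          Pi.zero_apply]
        rw [sub_eq_zero]
        refine Eq.trans ?_ (h3.symm.trans ?_)
        · exact Finset.sum_congr rfl fun ψ _ => mul_comm _ _
        · exact Finset.sum_congr rfl fun ψ _ => by ring
      have := linearIndependent_iff'.1 (linearIndependent_monoidHom T ℂ) s _ h1 χ hχ
      simpa [sub_eq_zero] using this
    have hv1 := hu 1
    rw [map_one, Matrix.one_mulVec] at hv1
    rw [hv1]
    refine Submodule.sum_mem _ fun χ hχ => Submodule.smul_mem _ _ (Submodule.subset_span ?_)
    exact ⟨χ, heig χ hχ⟩
  let b' := Module.Basis.ofSpan hspan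
  have hfin := FiniteDimensional.fintypeBasisIndex b'
  have hcard := Module.finrank_eq_card_basis b'
  rw [Module.finrank_fin_fun] at hcard
  let e := Fintype.equivFinOfCardEq hcard.symm
  have hb : ∀ i, ∃ χ : T →* ℂ, ∀ t, (π t).mulVec (b'.reindex e i) = χ t • b'.reindex e i := by
    intro i
    rw [Module.Basis.reindex_apply]
    exact Module.Basis.ofSpan_subset hspan ⟨_, rfl⟩
  choose χ hχ using hb
  exact ⟨b'.reindex e, χ, fun t i => hχ i t⟩

/-- On (ℂˣ)^r the entries are Laurent polynomials in the coordinates, which are themselves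
characters. -/
theorem IsTorus.groupCoord_mem {N : ℕ} {G : Subgroup (GL (Fin (N + 1)) ℂ)} {T : Subgroup G}
    (hT : IsTorus T) (c) :
    (fun t : T => groupCoord ((t : G) : GL (Fin (N + 1)) ℂ) c) ∈ characterAlgebra T := by
  obtain ⟨r, φ, hφ, -⟩ := hT
  obtain ⟨P, hP⟩ := hφ c
  have h1 : (fun t : T => groupCoord ((t : G) : GL (Fin (N + 1)) ℂ) c) = fun t : T =>
      MvPolynomial.eval (Sum.elim (fun k => (φ.symm t k : ℂ)) (fun k => ((φ.symm t k)⁻¹ : ℂ)))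
        P := by
    funext t
    simpa using hP (φ.symm t)
  rw [h1]
  refine eval_mem_subalgebra _ _ (fun k => ?_) P
  rcases k with k | k
  · exact Algebra.subset_adjoin ⟨(Units.coeHom ℂ).comp
      ((Pi.evalMonoidHom (fun _ : Fin r => ℂˣ) k).comp φ.symm.toMonoidHom), rfl⟩
  · refine Algebra.subset_adjoin ⟨(Units.coeHom ℂ).comp
      ((Pi.evalMonoidHom (fun _ : Fin r => ℂˣ) k).comp φ.symm.toMonoidHom)⁻¹, ?_⟩
    funext t
    simp

theorem IsTorus.exists_eigenbasis {N : ℕ} {G : Subgroup (GL (Fin (N + 1)) ℂ)} {T : Subgroup G}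
    (hT : IsTorus T) :
    ∃ (b : Module.Basis (Fin (N + 1)) ℂ (Fin (N + 1) → ℂ)) (χ : Fin (N + 1) → charGroup T),
      ∀ (t : T) i, (((t : G) : GL (Fin (N + 1)) ℂ) :
        Matrix (Fin (N + 1)) (Fin (N + 1)) ℂ).mulVec (b i) = ((χ i : T →* ℂˣ) t : ℂ) • b i := by
  obtain ⟨b, χ, h⟩ := exists_eigenbasis_of_entries_mem
    ((Units.coeHom (Matrix (Fin (N + 1)) (Fin (N + 1)) ℂ)).comp (G.subtype.comp T.subtype))
    (fun i j => hT.groupCoord_mem (Sum.inl (i, j)))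
  -- At a nonzero coordinate j of `b i`, the eigenvalue is (t b_i)_j / (b_i)_j, which is linear in
  -- the entries of t.
  have hreg : ∀ i, IsRegularFun T (fun t => ((χ i).toHomUnits t : ℂ)) := by
    intro i
    obtain ⟨j, hj⟩ := Function.ne_iff.1 (b.ne_zero i)
    refine ⟨∑ k, MvPolynomial.C ((b i j)⁻¹ * b i k) * MvPolynomial.X (Sum.inl (j, k)), fun t => ?_⟩
    have h1 := congrFun (h t i) j
    rw [Pi.smul_apply, smul_eq_mul, ← div_eq_iff hj] at h1
    refine (MonoidHom.coe_toHomUnits _ _).trans ?_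
    rw [← h1]
    simp only [map_sum, map_mul, MvPolynomial.eval_C, MvPolynomial.eval_X]
    rw [Matrix.mulVec, dotProduct, div_eq_inv_mul, Finset.mul_sum]
    refine Finset.sum_congr rfl fun k _ => ?_
    simp only [groupCoord, Sum.elim_inl]
    rw [mul_assoc, mul_comm (b i k)]
    rfl
  exact ⟨b, fun i => ⟨(χ i).toHomUnits, hreg i⟩, fun t i => h t i⟩

end StablePair

/-! ### Weight polytopes and positivity of the degree -/

namespace StablePair

theorem sum_smul_mem_convexHull_of_sum_eq_zero {ι E : Type*} [Fintype ι] [Nonempty ι]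
    [AddCommGroup E] [Module ℝ E] (x : ι → E) (h : ∑ i, x i = 0) :
    (0 : E) ∈ convexHull ℝ (Set.range x) := by
  have h1 := (convex_convexHull ℝ (Set.range x)).sum_mem (t := Finset.univ)
    (w := fun _ : ι => ((Fintype.card ι : ℝ))⁻¹) (z := x) (fun i _ => by positivity)
    (by simp) (fun i _ => subset_convexHull _ _ ⟨i, rfl⟩)
  rwa [← Finset.smul_sum, h, smul_zero] at h1

/-- Here -x_i is the sum of the other x_j, i.e. card ι times the average of the family with x_i
replaced by 0, and 0 is in the hull as the barycentre. -/
theorem neg_mem_smul_convexHull_of_sum_eq_zero {ι E : Type*} [Fintype ι]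
    [AddCommGroup E] [Module ℝ E] (x : ι → E) (h : ∑ i, x i = 0) (i : ι) :
    -x i ∈ (Fintype.card ι : ℝ) • convexHull ℝ (Set.range x) := by
  classical
  have hne : Nonempty ι := ⟨i⟩
  have hcard : (Fintype.card ι : ℝ) ≠ 0 := by exact_mod_cast Fintype.card_ne_zero
  have h1 := (convex_convexHull ℝ (Set.range x)).sum_mem (t := Finset.univ)
    (w := fun _ : ι => ((Fintype.card ι : ℝ))⁻¹) (z := fun j => if j = i then 0 else x j)
    (fun i _ => by positivity) (by simp) (fun j _ => by
      by_cases hj : j = i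
      · simpa [hj] using sum_smul_mem_convexHull_of_sum_eq_zero x h
      · simpa [hj] using subset_convexHull ℝ (Set.range x) ⟨j, rfl⟩)
  refine ⟨_, h1, ?_⟩
  simp only
  rw [← Finset.smul_sum, smul_smul, mul_inv_cancel₀ hcard, one_smul, eq_neg_iff_add_eq_zero,
    Finset.sum_ite, Finset.sum_const_zero, zero_add, Finset.filter_ne' Finset.univ i,
    Finset.sum_erase_add _ _ (Finset.mem_univ i)]
  exact h

variable {N : ℕ} {G : Subgroup (GL (Fin (N + 1)) ℂ)}

theorem charVec_one (T : Subgroup G) : charVec T 1 = 0 := by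
  simp [charVec]

theorem charVec_mul (T : Subgroup G) (χ ψ : charGroup T) :
    charVec T (χ * ψ) = charVec T χ + charVec T ψ := by
  simp [charVec, TensorProduct.tmul_add]

theorem charVec_inv (T : Subgroup G) (χ : charGroup T) : charVec T χ⁻¹ = -charVec T χ := by
  simp [charVec, TensorProduct.tmul_neg]

theorem charVec_prod (T : Subgroup G) {ι : Type*} (s : Finset ι) (χ : ι → charGroup T) :
    charVec T (∏ i ∈ s, χ i) = ∑ i ∈ s, charVec T (χ i) := by
  classical
  induction s using Finset.induction_on with
  | empty => simp [charVec_one]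
  | insert a s ha ih => rw [Finset.prod_insert ha, Finset.sum_insert ha, charVec_mul, ih]

theorem charVec_pow (T : Subgroup G) (χ : charGroup T) (k : ℕ) :
    charVec T (χ ^ k) = (k : ℝ) • charVec T χ := by
  induction k with
  | zero => simp [charVec_one]
  | succ k ih => rw [pow_succ, charVec_mul, ih]; push_cast; rw [add_smul, one_smul]

/-- The functions underlying the regular characters. -/
def charFun (T : Subgroup G) : charGroup T →* (T → ℂ) where
  toFun χ t := ((χ : T →* ℂˣ) t : ℂ)
  map_one' := by funext t; simp
  map_mul' χ ψ := by funext t; simp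

theorem linearIndependent_charFun (T : Subgroup G) : LinearIndependent ℂ (charFun T) := by
  refine (linearIndependent_monoidHom T ℂ).comp
    (fun χ : charGroup T => (Units.coeHom ℂ).comp (χ : T →* ℂˣ)) fun χ ψ h => ?_
  ext t
  exact DFunLike.congr_fun h t

/-- The identity, the given elements and their inverses. -/
def signedSet {A ι : Type*} [Group A] (χ : ι → A) : Set A :=
  insert 1 (Set.range χ ∪ Set.range fun i => (χ i)⁻¹)

/-- Each letter of a word of length `D` contributes a point of (card ι) · hull, and dilates of a
convex set add. -/
theorem mem_smul_convexHull_of_mem_signedSet_pow {A E ι : Type*} [CommGroup A] [AddCommGroup E]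
    [Module ℝ E] [Fintype ι] [Nonempty ι] (F : A → E) (F_one : F 1 = 0)
    (F_mul : ∀ a b, F (a * b) = F a + F b) (F_inv : ∀ a, F a⁻¹ = -F a)
    (χ : ι → A) (h : ∑ i, F (χ i) = 0) (D : ℕ) {ψ : A} (hψ : ψ ∈ signedSet χ ^ D) :
    F ψ ∈ ((D * Fintype.card ι : ℕ) : ℝ) • convexHull ℝ (Set.range fun i => F (χ i)) := by
  have h0 := sum_smul_mem_convexHull_of_sum_eq_zero _ h
  induction D generalizing ψ with
  | zero =>
    rw [pow_zero, Set.mem_one] at hψ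
    subst hψ
    exact ⟨0, h0, by simp [F_one]⟩
  | succ D ih =>
    rw [pow_succ] at hψ
    obtain ⟨α, hα, β, hβ, rfl⟩ := Set.mem_mul.1 hψ
    rw [F_mul, add_mul, one_mul, Nat.cast_add, (convex_convexHull ℝ _).add_smul
      (Nat.cast_nonneg _) (Nat.cast_nonneg _)]
    refine Set.add_mem_add (ih hα) ?_
    have hc : (1 : ℝ) ≤ Fintype.card ι := by exact_mod_cast Fintype.card_pos
    rcases hβ with rfl | ⟨i, rfl⟩ | ⟨i, rfl⟩
    · exact ⟨0, h0, by simp [F_one]⟩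
    · rw [Set.mem_smul_set_iff_inv_smul_mem₀ (by positivity)]
      exact (convex_convexHull ℝ _).smul_mem_of_zero_mem h0
        (subset_convexHull _ _ ⟨i, rfl⟩) ⟨by positivity, inv_le_one_of_one_le₀ hc⟩
    · rw [F_inv]
      exact neg_mem_smul_convexHull_of_sum_eq_zero (fun i => F (χ i)) h i

theorem det_eq_prod_of_mulVec_basis {n : Type*} [Fintype n] [DecidableEq n]
    (b : Module.Basis n ℂ (n → ℂ)) (A : Matrix n n ℂ) (μ : n → ℂ)
    (h : ∀ i, A.mulVec (b i) = μ i • b i) : A.det = ∏ i, μ i := by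
  have h1 : LinearMap.toMatrix b b (Matrix.toLin' A) = Matrix.diagonal μ := by
    ext i j
    rw [LinearMap.toMatrix_apply, Matrix.toLin'_apply, h, map_smul, b.repr_self,
      Matrix.diagonal_apply, Finsupp.smul_apply, Finsupp.single_apply]
    by_cases hij : i = j
    · simp [hij]
    · simp [hij, Ne.symm hij]
  rw [← LinearMap.det_toLin', ← LinearMap.det_toMatrix b, h1, Matrix.det_diagonal]

/-- Diagonal characters of a torus in an eigenbasis. -/
structure IsEigenbasis (T : Subgroup G) (b : Module.Basis (Fin (N + 1)) ℂ (Fin (N + 1) → ℂ))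
    (χ : Fin (N + 1) → charGroup T) : Prop where
  mulVec : ∀ (t : T) i, (((t : G) : GL (Fin (N + 1)) ℂ) :
    Matrix (Fin (N + 1)) (Fin (N + 1)) ℂ).mulVec (b i) = charFun T (χ i) t • b i

namespace IsEigenbasis

variable {T : Subgroup G} {b : Module.Basis (Fin (N + 1)) ℂ (Fin (N + 1) → ℂ)}
  {χ : Fin (N + 1) → charGroup T}

theorem prod_pow_eq_one (h : IsEigenbasis T b χ) {k : ℕ}
    (hdet : ∀ g ∈ G, (g : Matrix (Fin (N + 1)) (Fin (N + 1)) ℂ).det ^ k = 1) :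
    (∏ i, χ i) ^ k = 1 := by
  apply (linearIndependent_charFun T).injective
  funext t
  have h1 : charFun T ((∏ i, χ i) ^ k) t = (∏ i, charFun T (χ i) t) ^ k := by
    rw [map_pow, map_prod, Pi.pow_apply, Finset.prod_apply]
  rw [h1, ← det_eq_prod_of_mulVec_basis b _ _ (h.mulVec t), hdet _ (t : G).2, map_one]
  rfl

/-- The product of the χ_i is det restricted to `T`, hence torsion, and torsion dies in M_ℝ. -/
theorem sum_charVec_eq_zero (h : IsEigenbasis T b χ) {k : ℕ} (hk : 0 < k)
    (hdet : ∀ g ∈ G, (g : Matrix (Fin (N + 1)) (Fin (N + 1)) ℂ).det ^ k = 1) :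
    ∑ i, charVec T (χ i) = 0 := by
  have h2 := congrArg (charVec T) (h.prod_pow_eq_one hdet)
  rw [charVec_pow, charVec_prod, charVec_one] at h2
  exact (smul_eq_zero.1 h2).resolve_left (Nat.cast_ne_zero.2 hk.ne')

theorem inv_mulVec (h : IsEigenbasis T b χ) (t : T) (i) :
    ((((t : G) : GL (Fin (N + 1)) ℂ)⁻¹ : GL (Fin (N + 1)) ℂ) :
      Matrix (Fin (N + 1)) (Fin (N + 1)) ℂ).mulVec (b i) = charFun T (χ i)⁻¹ t • b i := by
  have := h.mulVec t⁻¹ i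
  simpa [charFun] using this

theorem entry_mem_span {B : Set (charGroup T)} {A : T → Matrix (Fin (N + 1)) (Fin (N + 1)) ℂ}
    {ψ : Fin (N + 1) → charGroup T} (hψ : ∀ i, ψ i ∈ B)
    (h : ∀ t i, (A t).mulVec (b i) = charFun T (ψ i) t • b i) (j k : Fin (N + 1)) :
    (fun t => A t j k) ∈ Submodule.span ℂ (charFun T '' B) := by
  have h1 : (fun t => A t j k) =
      ∑ i, (b.repr (Pi.single k 1) i * b i j) • charFun T (ψ i) := by
    funext t
    have h2 : A t j k = (A t).mulVec (∑ i, b.repr (Pi.single k 1) i • b i) j := by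
      rw [b.sum_repr]
      simp
    rw [h2, Matrix.mulVec_sum, Finset.sum_apply, Finset.sum_apply]
    refine Finset.sum_congr rfl fun i _ => ?_
    rw [Matrix.mulVec_smul, h]
    simp only [Pi.smul_apply, smul_eq_mul]
    ring
  rw [h1]
  exact Submodule.sum_mem _ fun i _ => Submodule.smul_mem _ _
    (Submodule.subset_span ⟨_, hψ i, rfl⟩)

theorem groupCoord_mem_span (h : IsEigenbasis T b χ) (c) :
    (fun t : T => groupCoord ((t : G) : GL (Fin (N + 1)) ℂ) c) ∈
      Submodule.span ℂ (charFun T '' signedSet χ) := by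
  rcases c with ⟨j, k⟩ | ⟨j, k⟩
  · exact entry_mem_span (fun i => Or.inr (Or.inl ⟨i, rfl⟩)) h.mulVec j k
  · exact entry_mem_span (fun i => Or.inr (Or.inr ⟨i, rfl⟩)) h.inv_mulVec j k

/-- The identity is the sum of the rank-one projectors E_j onto the lines of the eigenbasis, and E_j
has weight χ_j. Projectors with equal weight are grouped; their sum still sends b_i to b_i ≠ 0. -/
theorem mem_weightSupport_one (h : IsEigenbasis T b χ) (i) :
    χ i ∈ weightSupport (leftRegular G) T 1 := by
  classical
  let E : Fin (N + 1) → Matrix (Fin (N + 1)) (Fin (N + 1)) ℂ := fun j =>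
    LinearMap.toMatrix' ((b.coord j).smulRight (b j))
  have hE : ∀ j x, (E j).mulVec x = b.repr x j • b j := fun j x => by
    rw [← Matrix.toLin'_apply, Matrix.toLin'_toMatrix']
    rfl
  have happ : ∀ ψ, (∑ j, Finsupp.single (χ j) (E j)) ψ = ∑ j, if χ j = ψ then E j else 0 := by
    intro ψ
    simp [Finsupp.finsetSum_apply, Finsupp.single_apply]
  refine ⟨∑ j, Finsupp.single (χ j) (E j), fun ψ t => ?_, ?_, fun h0 => ?_⟩
  · rw [happ, map_sum, Finset.smul_sum]
    refine Finset.sum_congr rfl fun j _ => ?_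
    split_ifs with hj
    · subst hj
      refine Matrix.ext_of_mulVec_single fun l => ?_
      change ((((t : G) : GL (Fin (N + 1)) ℂ) :
        Matrix (Fin (N + 1)) (Fin (N + 1)) ℂ) * E j).mulVec _ = _
      rw [← Matrix.mulVec_mulVec, hE, Matrix.mulVec_smul, h.mulVec, Matrix.smul_mulVec, hE,
        smul_comm]
      rfl
    · simp
  · have hs : (∑ j, Finsupp.single (χ j) (E j)).sum (fun _ x => x) = ∑ j, E j := by
      rw [← Finsupp.sum_finsetSum_index (fun _ => rfl) (fun _ _ _ => rfl)]
      exact Finset.sum_congr rfl fun j _ => Finsupp.sum_single_index rfl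
    rw [hs]
    refine Matrix.ext_of_mulVec_single fun l => ?_
    rw [Matrix.sum_mulVec, Matrix.one_mulVec]
    simp only [hE]
    exact b.sum_repr _
  · have h1 := congrArg (fun A => A.mulVec (b i)) h0
    simp only [happ, Matrix.sum_mulVec, Matrix.zero_mulVec] at h1
    rw [Finset.sum_eq_single i] at h1
    · rw [if_pos rfl, hE, b.repr_self, Finsupp.single_eq_same, one_smul] at h1
      exact b.ne_zero i h1
    · intro j _ hj
      split_ifs with hji
      · rw [hE, b.repr_self, Finsupp.single_eq_of_ne (by tauto), zero_smul]
      · simp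
    · simp

end IsEigenbasis

/-- `D` is the largest degree of the matrix coefficients in one basis. It is independent of `T`, as
the degree quantifies over all maximal tori. -/
theorem IsRational.exists_degree_bound {V : Type*} [AddCommGroup V] [Module ℂ V]
    [FiniteDimensional ℂ V] {ρ : Representation ℂ G V} (hρ : IsRational ρ) :
    ∃ D : ℕ, ∀ (T : Subgroup G) (M : Submodule ℂ (T → ℂ)), 1 ≤ M →
      (∀ c, (fun t : T => groupCoord ((t : G) : GL (Fin (N + 1)) ℂ) c) ∈ M) →
      ∀ (l : Module.Dual ℂ V) (v : V), (fun t : T => l (ρ t v)) ∈ M ^ D := by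
  let e := Module.finBasis ℂ V
  choose P hP using fun i j => hρ (e.coord i) (e j)
  refine ⟨Finset.univ.sup fun p : Fin (Module.finrank ℂ V) × Fin (Module.finrank ℂ V) =>
    (P p.1 p.2).totalDegree, fun T M h1 hM l v => ?_⟩
  have h2 : (fun t : T => l (ρ t v)) = ∑ i, ∑ j, (l (e i) * e.repr v j) • fun t : T =>
      MvPolynomial.eval (groupCoord ((t : G) : GL (Fin (N + 1)) ℂ)) (P i j) := by
    funext t
    have h3 : ρ t v = ∑ i, (∑ j, e.repr v j * e.coord i (ρ t (e j))) • e i := by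
      conv_lhs => rw [← e.sum_repr (ρ t v)]
      refine Finset.sum_congr rfl fun i _ => ?_
      congr 1
      conv_lhs => rw [← e.sum_repr v]
      rw [map_sum, map_sum, Finsupp.finsetSum_apply]
      refine Finset.sum_congr rfl fun j _ => ?_
      simp
    rw [h3, map_sum, Finset.sum_apply]
    refine Finset.sum_congr rfl fun i _ => ?_
    rw [map_smul, smul_eq_mul, Finset.sum_mul, Finset.sum_apply]
    refine Finset.sum_congr rfl fun j _ => ?_
    rw [hP, Pi.smul_apply, smul_eq_mul]
    ring
  rw [h2]
  refine Submodule.sum_mem _ fun i _ => Submodule.sum_mem _ fun j _ => Submodule.smul_mem _ _ ?_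
  exact eval_mem_pow h1 _ hM _ (Finset.le_sup
    (f := fun p : Fin (Module.finrank ℂ V) × Fin (Module.finrank ℂ V) =>
      (P p.1 p.2).totalDegree) (Finset.mem_univ (i, j)))

/-- Taking for `M` the span of the letters, `M ^ D` is spanned by words of length `D`; by
independence a character in this span is one of these words. -/
theorem IsEigenbasis.mem_signedSet_pow {T : Subgroup G}
    {b : Module.Basis (Fin (N + 1)) ℂ (Fin (N + 1) → ℂ)} {χ : Fin (N + 1) → charGroup T}
    (h : IsEigenbasis T b χ) {D : ℕ} {ψ : charGroup T}
    (hψ : ∀ M : Submodule ℂ (T → ℂ), 1 ≤ M →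
      (∀ c, (fun t : T => groupCoord ((t : G) : GL (Fin (N + 1)) ℂ) c) ∈ M) →
      charFun T ψ ∈ M ^ D) : ψ ∈ signedSet χ ^ D := by
  have h1 : 1 ≤ Submodule.span ℂ (charFun T '' signedSet χ) := by
    rw [Submodule.one_le]
    exact Submodule.subset_span ⟨1, Or.inl rfl, map_one _⟩
  have h2 := hψ _ h1 h.groupCoord_mem_span
  rw [Submodule.span_pow, ← Set.image_pow] at h2
  by_contra hn
  exact (linearIndependent_charFun T).notMem_span_image hn h2

theorem charFun_eq_of_apply_eq_smul {V : Type*} [AddCommGroup V] [Module ℂ V]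
    {ρ : Representation ℂ G V} {T : Subgroup G} {ψ : charGroup T} {u : V} (hu : u ≠ 0)
    (h : ∀ t : T, ρ (t : G) u = ((ψ : T →* ℂˣ) t : ℂ) • u) :
    ∃ l : Module.Dual ℂ V, (fun t : T => l (ρ t u)) = charFun T ψ := by
  obtain ⟨l, hl⟩ := Module.Projective.exists_dual_eq_one ℂ hu
  refine ⟨l, funext fun t => ?_⟩
  rw [h, map_smul, hl, smul_eq_mul, mul_one]
  rfl

theorem IsEigenbasis.weightPolytope_subset {V : Type*} [AddCommGroup V] [Module ℂ V]
    {ρ : Representation ℂ G V} {T : Subgroup G}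
    {b : Module.Basis (Fin (N + 1)) ℂ (Fin (N + 1) → ℂ)} {χ : Fin (N + 1) → charGroup T}
    (hb : IsEigenbasis T b χ) (h0 : ∑ i, charVec T (χ i) = 0) {D : ℕ} {v : V}
    (hD : ∀ ψ ∈ weightSupport ρ T v, ψ ∈ signedSet χ ^ D) :
    weightPolytope ρ T v ⊆ ((D * Fintype.card (Fin (N + 1)) : ℕ) : ℝ) •
      weightPolytope (leftRegular G) T 1 := by
  have hsub : (Set.range fun i => charVec T (χ i)) ⊆
      charVec T '' weightSupport (leftRegular G) T 1 := by
    rintro _ ⟨i, rfl⟩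
    exact ⟨χ i, hb.mem_weightSupport_one i, rfl⟩
  refine convexHull_min ?_ ((convex_convexHull ℝ _).smul _)
  rintro _ ⟨ψ, hψ, rfl⟩
  exact Set.smul_set_mono (convexHull_mono hsub) (mem_smul_convexHull_of_mem_signedSet_pow
    (charVec T) (charVec_one T) (charVec_mul T) (charVec_inv T) χ h0 D (hD ψ hψ))

/-- The degree of a rational module is attained; in particular it is positive. -/
theorem IsRational.repDegree_pos {V : Type*} [AddCommGroup V] [Module ℂ V]
    [FiniteDimensional ℂ V] {ρ : Representation ℂ G V} (hρ : IsRational ρ) {k : ℕ} (hk : 0 < k)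
    (hdet : ∀ g ∈ G, (g : Matrix (Fin (N + 1)) (Fin (N + 1)) ℂ).det ^ k = 1) :
    0 < repDegree ρ := by
  obtain ⟨D, hD⟩ := hρ.exists_degree_bound
  -- The infimum of an empty set would be 0, so positivity amounts to exhibiting one admissible
  -- multiple.
  refine (Nat.sInf_mem (s := {k | 0 < k ∧ ∀ T : Subgroup G, IsMaximalTorus T → ∀ v : V, v ≠ 0 →
    weightPolytope ρ T v ⊆ (k : ℝ) • weightPolytope (leftRegular G) T 1}) ?_).1
  -- `D + 1` keeps the multiple positive even when `D = 0`.
  refine ⟨(D + 1) * Fintype.card (Fin (N + 1)),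
    Nat.mul_pos (Nat.succ_pos _) Fintype.card_pos, fun T hT v _ => ?_⟩
  obtain ⟨b, χ, hbχ⟩ := hT.prop.exists_eigenbasis
  have hb : IsEigenbasis T b χ := ⟨hbχ⟩
  refine hb.weightPolytope_subset (hb.sum_charVec_eq_zero hk hdet) ?_
  rintro ψ ⟨f, hf, -, hψ⟩
  obtain ⟨l, hl⟩ := charFun_eq_of_apply_eq_smul hψ (hf ψ)
  refine hb.mem_signedSet_pow fun M h1 hM => ?_
  rw [← hl]
  exact pow_le_pow_right₀ h1 (Nat.le_succ D) (hD T M h1 hM l (f ψ))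

theorem finite_pairAut {V W : Type*} [AddCommGroup V] [Module ℂ V] [FiniteDimensional ℂ V]
    [AddCommGroup W] [Module ℂ W] {ρ : Representation ℂ G V} {τ : Representation ℂ G W}
    {v : V} {w : W} (hG : IsZariskiClosed G) {k : ℕ} (hk : 0 < k)
    (hdet : ∀ g ∈ G, (g : Matrix (Fin (N + 1)) (Fin (N + 1)) ℂ).det ^ k = 1)
    (hρ : IsRational ρ) (hτ : IsRational τ) (hv : v ≠ 0) (hw : w ≠ 0)
    (h : IsStablePair ρ τ v w) : Finite (pairAut ρ τ v w) := by
  obtain ⟨m, -, hm⟩ := h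
  obtain ⟨C, hC⟩ := exists_norm_le_of_mem_pairAut (hρ.repDegree_pos hk hdet) (fun g hg => by
    have h1 := congrArg norm (hdet g hg)
    rw [norm_pow, norm_one] at h1
    exact (pow_eq_one_iff_of_nonneg (norm_nonneg _) hk.ne').1 h1) hm hv
  exact finite_pairAut_of_bounded hG hρ hτ hv hw hC

end StablePair

/-! ### Automorphisms of a variety and its defining forms -/

namespace StablePair

variable {N : ℕ}

/-- Substituting a generic σ gives a polynomial `Q` in A whose coefficients are polynomials in the
entries of σ; a functional combines these coefficients linearly. -/
theorem isRational_polyRep (G : Subgroup (GL (Fin (N + 1)) ℂ)) (k r : ℕ) :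
    IsRational (polyRep G k r) := by
  intro l P
  obtain ⟨L, hL⟩ := LinearMap.exists_extend l
  let Q : MvPolynomial (Fin k × Fin (N + 1))
      (MvPolynomial ((Fin (N + 1) × Fin (N + 1)) ⊕ (Fin (N + 1) × Fin (N + 1))) ℂ) :=
    MvPolynomial.aeval (fun p : Fin k × Fin (N + 1) =>
      ∑ j, MvPolynomial.C (MvPolynomial.X (Sum.inl (j, p.2))) * MvPolynomial.X (p.1, j))
      (P : MvPolynomial (Fin k × Fin (N + 1)) ℂ)
  refine ⟨∑ n ∈ Q.support, MvPolynomial.C (L (MvPolynomial.monomial n 1)) * Q.coeff n, fun g => ?_⟩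
  have h1 : ((polyRep G k r g P : MvPolynomial.homogeneousSubmodule (Fin k × Fin (N + 1)) ℂ r) :
      MvPolynomial (Fin k × Fin (N + 1)) ℂ) =
      MvPolynomial.map (MvPolynomial.eval (groupCoord (g : GL (Fin (N + 1)) ℂ))) Q := by
    change polySubst k ((g : GL (Fin (N + 1)) ℂ) : Matrix (Fin (N + 1)) (Fin (N + 1)) ℂ)
      (P : MvPolynomial (Fin k × Fin (N + 1)) ℂ) = _
    simp only [Q]
    induction (P : MvPolynomial (Fin k × Fin (N + 1)) ℂ) using MvPolynomial.induction_on with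
    | C a => simp [polySubst, MvPolynomial.algebraMap_eq]
    | add p q hp hq => rw [map_add, map_add, map_add, hp, hq]
    | mul_X p c hp =>
      rw [map_mul, map_mul, map_mul, hp]
      congr 1
      simp [polySubst, groupCoord]
  have h2 : l (polyRep G k r g P) = L (polyRep G k r g P : MvPolynomial (Fin k × Fin (N + 1)) ℂ) := by
    rw [← hL]
    rfl
  rw [h2, h1]
  conv_lhs => rw [Q.as_sum]
  rw [map_sum, map_sum, map_sum]
  refine Finset.sum_congr rfl fun n _ => ?_
  rw [MvPolynomial.map_monomial, map_mul, MvPolynomial.eval_C, mul_comm, ← smul_eq_mul, ← map_smul,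
    MvPolynomial.smul_monomial, smul_eq_mul, mul_one]

theorem finiteDimensional_homogeneousSubmodule (σ : Type*) [Finite σ] (r : ℕ) :
    FiniteDimensional ℂ (MvPolynomial.homogeneousSubmodule σ ℂ r) :=
  Module.Finite.iff_fg.2 (MvPolynomial.homogeneousSubmodule_fg σ ℂ r)

/-- The substitution `x ↦ s x` on polynomial functions. -/
noncomputable def linSubst (s : Matrix (Fin (N + 1)) (Fin (N + 1)) ℂ) :
    MvPolynomial (Fin (N + 1)) ℂ →ₐ[ℂ] MvPolynomial (Fin (N + 1)) ℂ :=
  MvPolynomial.aeval fun i => ∑ j, MvPolynomial.C (s i j) * MvPolynomial.X j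

theorem eval_linSubst (s : Matrix (Fin (N + 1)) (Fin (N + 1)) ℂ) (x : Fin (N + 1) → ℂ)
    (F : MvPolynomial (Fin (N + 1)) ℂ) :
    MvPolynomial.eval x (linSubst s F) = MvPolynomial.eval (s.mulVec x) F := by
  induction F using MvPolynomial.induction_on with
  | C a => simp [linSubst, MvPolynomial.algebraMap_eq]
  | add p q hp hq => rw [map_add, map_add, map_add, hp, hq]
  | mul_X p c hp =>
    rw [map_mul, map_mul, map_mul, hp]
    congr 1
    simp [linSubst, Matrix.mulVec, dotProduct]

/-- Chain rule for F ∘ s, used to transport tangent spaces. -/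
theorem sum_pderiv_linSubst (s : Matrix (Fin (N + 1)) (Fin (N + 1)) ℂ) (x v : Fin (N + 1) → ℂ)
    (F : MvPolynomial (Fin (N + 1)) ℂ) :
    ∑ j, MvPolynomial.eval x (MvPolynomial.pderiv j (linSubst s F)) * v j =
      ∑ i, MvPolynomial.eval (s.mulVec x) (MvPolynomial.pderiv i F) * s.mulVec v i := by
  induction F using MvPolynomial.induction_on with
  | C a => simp [linSubst, MvPolynomial.algebraMap_eq]
  | add p q hp hq => simp only [map_add, add_mul, Finset.sum_add_distrib, hp, hq]
  | mul_X p c hp =>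
    have h1 : ∀ j, MvPolynomial.pderiv j (linSubst s (MvPolynomial.X c)) =
        MvPolynomial.C (s c j) := by
      intro j
      simp [linSubst, MvPolynomial.pderiv_X, Pi.single_apply]
    have h2 : MvPolynomial.eval x (linSubst s (MvPolynomial.X c)) = s.mulVec x c := by
      rw [eval_linSubst, MvPolynomial.eval_X]
    have h3 : ∀ i, MvPolynomial.eval (s.mulVec x)
        (MvPolynomial.pderiv i (MvPolynomial.X c : MvPolynomial (Fin (N + 1)) ℂ)) =
          if i = c then 1 else 0 := by
      intro i
      by_cases hi : i = c
      · subst hi; simp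
      · simp [hi, MvPolynomial.pderiv_X_of_ne (Ne.symm hi)]
    simp only [map_mul, MvPolynomial.pderiv_mul, map_add, h1, h2, h3, eval_linSubst,
      MvPolynomial.eval_C, MvPolynomial.eval_X, add_mul, Finset.sum_add_distrib]
    congr 1
    · calc _ = (∑ j, MvPolynomial.eval x (MvPolynomial.pderiv j (linSubst s p)) * v j)
            * s.mulVec x c := by
            rw [Finset.sum_mul]
            exact Finset.sum_congr rfl fun j _ => by ring
        _ = _ := by
            rw [hp, Finset.sum_mul]
            exact Finset.sum_congr rfl fun j _ => by ring
    · simp only [mul_assoc, ← Finset.mul_sum, ite_mul, one_mul, zero_mul, Finset.sum_ite_eq',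
        Finset.mem_univ, if_true]
      rfl

theorem mem_embTangent_iff {X : Set (ℙ ℂ (Fin (N + 1) → ℂ))} {x v : Fin (N + 1) → ℂ} :
    v ∈ embTangent X x ↔
      ∀ F ∈ homogIdeal X, ∑ i, MvPolynomial.eval x (MvPolynomial.pderiv i F) * v i = 0 := by
  simp [embTangent, Submodule.mem_iInf]

section Automorphisms

variable {G : Subgroup (GL (Fin (N + 1)) ℂ)} {X : Set (ℙ ℂ (Fin (N + 1) → ℂ))}

theorem mulVec_mem_embTangent {g : G} (hg : g ∈ varietyAut G X) {x v : Fin (N + 1) → ℂ}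
    (hv : v ∈ embTangent X x) :
    ((g : GL (Fin (N + 1)) ℂ) : Matrix (Fin (N + 1)) (Fin (N + 1)) ℂ).mulVec v ∈
      embTangent X (((g : GL (Fin (N + 1)) ℂ) :
        Matrix (Fin (N + 1)) (Fin (N + 1)) ℂ).mulVec x) := by
  rw [mem_embTangent_iff] at hv ⊢
  intro F hF
  rw [← sum_pderiv_linSubst]
  refine hv _ (MvPolynomial.mem_vanishingIdeal_iff.2 fun y hy => ?_)
  have := MvPolynomial.mem_vanishingIdeal_iff.1 hF _ ((hg y).2 hy)
  rw [← MvPolynomial.aeval_eq_eval] at *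
  simpa [eval_linSubst] using this

/-- The entries of `A s`, for the matrix `A` with entries `a`. -/
def mulRight (k : ℕ) (s : Matrix (Fin (N + 1)) (Fin (N + 1)) ℂ)
    (a : Fin k × Fin (N + 1) → ℂ) : Fin k × Fin (N + 1) → ℂ :=
  fun p => (toMat a * s) p.1 p.2

theorem toMat_mulRight (k : ℕ) (s : Matrix (Fin (N + 1)) (Fin (N + 1)) ℂ)
    (a : Fin k × Fin (N + 1) → ℂ) : toMat (mulRight k s a) = toMat a * s := rfl

theorem eval_polySubst (k : ℕ) (s : Matrix (Fin (N + 1)) (Fin (N + 1)) ℂ)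
    (a : Fin k × Fin (N + 1) → ℂ) (P : MvPolynomial (Fin k × Fin (N + 1)) ℂ) :
    MvPolynomial.eval a (polySubst k s P) = MvPolynomial.eval (mulRight k s a) P := by
  induction P using MvPolynomial.induction_on with
  | C a => simp [polySubst, MvPolynomial.algebraMap_eq]
  | add p q hp hq => rw [map_add, map_add, map_add, hp, hq]
  | mul_X p c hp =>
    rw [map_mul, map_mul, map_mul, hp]
    congr 1
    simp [polySubst, mulRight, toMat, Matrix.mul_apply, mul_comm]

theorem mulRight_mem_coisotropicSet {n k : ℕ} {g : G} (hg : g ∈ varietyAut G X)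
    {a : Fin k × Fin (N + 1) → ℂ} (ha : a ∈ coisotropicSet n k X) :
    mulRight k ((g : GL (Fin (N + 1)) ℂ) : Matrix (Fin (N + 1)) (Fin (N + 1)) ℂ) a ∈
      coisotropicSet n k X := by
  obtain ⟨hrank, x, hx, hax, hdim⟩ := ha
  set s := ((g : GL (Fin (N + 1)) ℂ) : Matrix (Fin (N + 1)) (Fin (N + 1)) ℂ) with hs
  set s' := (((g⁻¹ : G) : GL (Fin (N + 1)) ℂ) : Matrix (Fin (N + 1)) (Fin (N + 1)) ℂ) with hs'
  have hss' : s * s' = 1 := by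
    rw [hs, hs', ← Units.val_mul, ← Subgroup.coe_mul, mul_inv_cancel]
    rfl
  have hg' : g⁻¹ ∈ varietyAut G X := inv_mem hg
  have hmul : ∀ y, (toMat a * s).mulVec (s'.mulVec y) = (toMat a).mulVec y := fun y => by
    rw [Matrix.mulVec_mulVec, Matrix.mul_assoc, hss', Matrix.mul_one]
  -- ker (A s) = s⁻¹ ker A, so the witness and the tangent space move by s⁻¹.
  refine ⟨?_, s'.mulVec x, (hg' x).2 hx, ?_, ?_⟩
  · rw [toMat_mulRight, Matrix.rank_mul_eq_left_of_isUnit_det _ _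
      ((Matrix.isUnit_iff_isUnit_det _).1 (g : GL (Fin (N + 1)) ℂ).isUnit), hrank]
  · rw [toMat_mulRight, hmul, hax]
  · have hinj : Function.Injective (Matrix.mulVecLin s') := by
      intro y z hyz
      have := congrArg s.mulVec hyz
      simpa [Matrix.mulVec_mulVec, hss'] using this
    refine hdim.trans (Nat.add_le_add_left ?_ k)
    refine (LinearEquiv.finrank_eq (Submodule.equivMapOfInjective _ hinj _)).le.trans ?_
    refine Submodule.finrank_mono ?_
    rintro _ ⟨y, ⟨hy1, hy2⟩, rfl⟩
    refine ⟨?_, mulVec_mem_embTangent hg' hy2⟩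
    rw [SetLike.mem_coe, LinearMap.mem_ker, Matrix.mulVecLin_apply] at hy1 ⊢
    rw [toMat_mulRight, Matrix.mulVecLin_apply, hmul, hy1]

/-- A ↦ A g preserves the coisotropic set, hence its closure, the zero set of `P`. So the
substituted polynomial vanishes there, and the Nullstellensatz applies to the prime ideal (P). -/
theorem IsDefiningPoly.dvd_polySubst {n k : ℕ} {P : MvPolynomial (Fin k × Fin (N + 1)) ℂ}
    (hP : IsDefiningPoly n k X P) {g : G} (hg : g ∈ varietyAut G X) :
    P ∣ polySubst k ((g : GL (Fin (N + 1)) ℂ) : Matrix (Fin (N + 1)) (Fin (N + 1)) ℂ) P := by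
  obtain ⟨hirr, hzero⟩ := hP
  have hprime : (Ideal.span {P}).IsPrime :=
    (Ideal.span_singleton_prime hirr.ne_zero).2 hirr.prime
  rw [← Ideal.mem_span_singleton, ← MvPolynomial.IsPrime.vanishingIdeal_zeroLocus (K := ℂ)
    (Ideal.span {P})]
  refine MvPolynomial.mem_vanishingIdeal_iff.2 fun a ha => ?_
  have ha0 : a ∈ {a | MvPolynomial.eval a P = 0} := by
    have := ha P (Ideal.mem_span_singleton_self P)
    simpa using this
  rw [hzero] at ha0
  have h1 : mulRight k ((g : GL (Fin (N + 1)) ℂ) : Matrix (Fin (N + 1)) (Fin (N + 1)) ℂ) a ∈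
      {a | MvPolynomial.eval a P = 0} := by
    rw [hzero]
    intro F hF
    have := ha0 _ (show polySubst k _ F ∈ _ from MvPolynomial.mem_vanishingIdeal_iff.2
      fun c hc => by
        have := MvPolynomial.mem_vanishingIdeal_iff.1 hF _ (mulRight_mem_coisotropicSet hg hc)
        simpa [eval_polySubst] using this)
    simpa [eval_polySubst] using this
  simpa [eval_polySubst] using h1

theorem IsDefiningPoly.exists_polySubst_eq {n k : ℕ} {P : MvPolynomial (Fin k × Fin (N + 1)) ℂ}
    (hP : IsDefiningPoly n k X P) {g : G} (hg : g ∈ varietyAut G X) :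
    ∃ c : ℂ, c ≠ 0 ∧ polySubst k ((g : GL (Fin (N + 1)) ℂ) :
      Matrix (Fin (N + 1)) (Fin (N + 1)) ℂ) P = MvPolynomial.C c * P := by
  have h1 := hP.dvd_polySubst hg
  -- Applying g to P ∣ g⁻¹·P gives g·P ∣ P, so the two are associates and differ by a constant.
  have h2 := map_dvd (polySubst k ((g : GL (Fin (N + 1)) ℂ) :
      Matrix (Fin (N + 1)) (Fin (N + 1)) ℂ)) (hP.dvd_polySubst (inv_mem hg))
  rw [← AlgHom.comp_apply, ← polySubst_mul, ← Units.val_mul, ← Subgroup.coe_mul, mul_inv_cancel,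
    Subgroup.coe_one, Units.val_one, polySubst_one, AlgHom.id_apply] at h2
  obtain ⟨u, hu⟩ := associated_of_dvd_dvd h1 h2
  obtain ⟨c, hc, hcu⟩ := MvPolynomial.isUnit_iff_eq_C_of_isReduced.1 u.isUnit
  exact ⟨c, hc.ne_zero, by rw [← hu, hcu, mul_comm]⟩

theorem IsDefiningPoly.pow_mem_lineStabilizer {n k r e : ℕ}
    {P : MvPolynomial (Fin k × Fin (N + 1)) ℂ} (hP : IsDefiningPoly n k X P)
    (h : (P ^ e).IsHomogeneous r) {g : G} (hg : g ∈ varietyAut G X) :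
    g ∈ lineStabilizer (polyRep G k r) ⟨P ^ e, h⟩ := by
  obtain ⟨c, hc, hgc⟩ := hP.exists_polySubst_eq hg
  refine ⟨Units.mk0 (c ^ e) (pow_ne_zero _ hc), Subtype.ext ?_⟩
  change polySubst k _ (P ^ e) = (c ^ e) • P ^ e
  rw [map_pow, hgc, mul_pow, ← map_pow, MvPolynomial.smul_eq_C_mul]

theorem finite_varietyAut (hG : IsZariskiClosed G) {k : ℕ} (hk : 0 < k)
    (hdet : ∀ g ∈ G, (g : Matrix (Fin (N + 1)) (Fin (N + 1)) ℂ).det ^ k = 1) {n : ℕ}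
    (h : IsStableVariety G n X) : Finite (varietyAut G X) := by
  obtain ⟨R, D, a, b, hR, hD, hXR, hXD, hst⟩ := h
  have h1 := finiteDimensional_homogeneousSubmodule (Fin (n + 1) × Fin (N + 1)) (a * b)
  have hfin := finite_pairAut hG hk hdet (isRational_polyRep G _ _) (isRational_polyRep G _ _)
    (fun h0 => pow_ne_zero b hXR.1.ne_zero (congrArg Subtype.val h0))
    (fun h0 => pow_ne_zero a hXD.1.ne_zero (congrArg Subtype.val h0)) hst
  have hle : varietyAut G X ≤ pairAut (polyRep G (n + 1) (a * b)) (polyRep G n (a * b))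
      ⟨R ^ b, hR.pow b⟩ ⟨D ^ a, mul_comm b a ▸ hD.pow a⟩ := fun g hg =>
    ⟨hXR.pow_mem_lineStabilizer _ hg, hXD.pow_mem_lineStabilizer _ hg⟩
  exact Finite.of_injective _ (Subgroup.inclusion_injective hle)

end Automorphisms

end StablePair

theorem mainTheorem7 (N : ℕ) (G : Subgroup (GL (Fin (N + 1)) ℂ))
    (hG : StablePair.IsZariskiClosed G)
    (hdet : ∃ k : ℕ, 0 < k ∧ ∀ g ∈ G, (g : Matrix (Fin (N + 1)) (Fin (N + 1)) ℂ).det ^ k = 1) :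
    (∀ (V : Type*) [AddCommGroup V] [Module ℂ V] [FiniteDimensional ℂ V]
       (W : Type*) [AddCommGroup W] [Module ℂ W] [FiniteDimensional ℂ W]
       (ρ : Representation ℂ G V) (τ : Representation ℂ G W),
       StablePair.IsRational ρ → StablePair.IsRational τ →
       ∀ (v : V) (w : W), v ≠ 0 → w ≠ 0 → StablePair.IsStablePair ρ τ v w →
         Finite (StablePair.pairAut ρ τ v w)) ∧
    (∀ (n : ℕ) (X : Set (ℙ ℂ (Fin (N + 1) → ℂ))), StablePair.IsSmoothVariety n X →
       StablePair.IsStableVariety G n X → Finite (StablePair.varietyAut G X)) := by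
  obtain ⟨k, hk, hdet⟩ := hdet
  refine ⟨?_, fun n X _ h => StablePair.finite_varietyAut hG hk hdet h⟩
  intro V _ _ _ W _ _ _ ρ τ hρ hτ v w hv hw h
  exact StablePair.finite_pairAut hG hk hdet hρ hτ hv hw h
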